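/- **Conventions.** For a partition $\lambda$ let $D(\lambda)=\{(i,j)\in\mathbb Z^2: i\ge 1,\ 1\le j\le\lambda_i\}$, and for $\mu\subset\lambda$ let $D=D(\lambda/\mu)=D(\lambda)\setminus D(\mu)$. The *content* of the box $(i,j)$ (row $i$, column $j$, rows numbered downwards) is $j-i$. Fix a positive integer $N$ and let $[\overline N]=\{1<\overline 1<2<\overline 2<\cdots<N<\overline N\}$, $|i|=i$, $|\overline i|=i^{-1}$. For a finite set $E$ of boxes, a *symplectic tableau* on $E$ is a filling $M=(m_{ij})$ of $E$ by letters of $[\overline N]$ that is weakly increasing along rows, strictly increasing down columns, and has all entries in boxes of content $-k$ at least $k+1$. For $\boldsymbol t=(t_{ij})\in\mathbb C^E$ put $$\zeta_E^{\mathrm{sp},N}(\boldsymbol t)=\sum_{M}\ \prod_{(i,j)\in E}|m_{ij}|^{-t_{ij}},$$ the sum being over all symplectic tableaux on $E$; in particular $\zeta^{\mathrm{sp},N}_\emptyset=1$. Write $\zeta^{\mathrm{sp},N}_{\lambda/\mu}=\zeta^{\mathrm{sp},N}_{D(\lambda/\mu)}$. A *strip* is a nonempty edgewise connected skew diagram without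 a $2\times2$ block of boxes; its *starting box* is its bottommost and leftmost box, its *ending box* its topmost and rightmost box. An *outside decomposition* of $\lambda/\mu$ is a sequence $(\theta_1,\dots,\theta_r)$ of pairwise disjoint strips with union $D$ such that each starting box lies on the left or bottom perimeter of $D$ (its left or lower neighbour is not in $D$) and each ending box lies on the right or top perimeter of $D$ (its right or upper neighbour is not in $D$). A box of $\theta_i$ is *approached from the left* (*from below*) if its left (lower) neighbour belongs to $\theta_i$; a starting box is approached from the left if it lies on the left perimeter and from below if it lies on the bottom perimeter, either choice being allowed if both hold. A *direction assignment* chooses for every $c\in\mathbb Z$ one of the two directions such that all boxes of $D$ of content $c$ are approached from that direction; for contents that do not occur in $D$ the choice is arbitrary. Given a direction assignment, let $c_j$ be the content of the starting box of $\theta_j$ and $d_i$ that of the ending box of $\theta_i$. If $d_i\ge c_j-1$, then $\theta_i\#\theta_j$ is the strip with one box of each content $c_j,c_j+1,\dots,d_i$ that begins at the starting box of $\theta_j$ and in which each further box is placed to the right of, or above, its predecessor according as its content is approached from the left or from below (so $\theta_i\#\theta_j=\emptyset$ if $d_i=c_j-1$). If $d_i<c_j-1$, then $\theta_i\#\theta_j$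 is undefined and $\zeta^{\mathrm{sp},N}_{\theta_i\#\theta_j}$ is read as $0$. **Theorem.** Let $\mu\subset\lambda$ be partitions, let $\boldsymbol s=(s_{ij})\in\mathbb C^{D(\lambda/\mu)}$ be constant along diagonals, $s_{ij}=a_{j-i}$ (with $a_c\in\mathbb C$ arbitrary for contents $c$ that do not occur in $D(\lambda/\mu)$), and let $(\theta_1,\dots,\theta_r)$ be an outside decomposition of $\lambda/\mu$. Then a direction assignment exists, and for every direction assignment $$\zeta^{\mathrm{sp},N}_{\lambda/\mu}(\boldsymbol s)=\det\Bigl(\zeta^{\mathrm{sp},N}_{\theta_i\#\theta_j}(\boldsymbol s_{\theta_i}\#\boldsymbol s_{\theta_j})\Bigr)_{1\le i,j\le r},$$ where $\boldsymbol s_{\theta_i}\#\boldsymbol s_{\theta_j}$ is the filling of $\theta_i\#\theta_j$ with $a_c$ in the box of content $c$. -/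

import Mathlib

/-! Boxes are pairs `(i, j)` of integers: row `i` (counted downwards), column `j`
(counted from left to right). -/

namespace SpZeta

/-- The content `j - i` of the box in row `i` and column `j`. -/
def content (p : ℤ × ℤ) : ℤ := p.2 - p.1

/-- The box immediately to the left of `p`. -/
def leftOf (p : ℤ × ℤ) : ℤ × ℤ := (p.1, p.2 - 1)

/-- The box immediately to the right of `p`. -/
def rightOf (p : ℤ × ℤ) : ℤ × ℤ := (p.1, p.2 + 1)

/-- The box immediately above `p`. -/
def above (p : ℤ × ℤ) : ℤ × ℤ := (p.1 - 1, p.2)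

/-- The box immediately below `p`. -/
def below (p : ℤ × ℤ) : ℤ × ℤ := (p.1 + 1, p.2)

/-- The diagram `D(lam/mu) = D(lam) \ D(mu)`, with rows and columns numbered from `1`. -/
def skewDiagram (lam mu : YoungDiagram) : Finset (ℤ × ℤ) :=
  (lam.cells \ mu.cells).image fun c => ((c.1 : ℤ) + 1, (c.2 : ℤ) + 1)

/-- Two boxes are adjacent if they share an edge. -/
def edgeGraph : SimpleGraph (ℤ × ℤ) where
  Adj p q := |p.1 - q.1| + |p.2 - q.2| = 1
  symm := ⟨fun p q h => by rwa [abs_sub_comm q.1 p.1, abs_sub_comm q.2 p.2]⟩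
  loopless := ⟨fun p h => by simp at h⟩

/-- A strip: a (nonempty) skew diagram which is edgewise connected and contains no
`2 × 2` block of boxes. -/
structure IsStrip (t : Finset (ℤ × ℤ)) : Prop where
  skew : ∃ al be : YoungDiagram, be ≤ al ∧ t = skewDiagram al be
  connected : (edgeGraph.induce (t : Set (ℤ × ℤ))).Connected
  no_block : ∀ i j : ℤ,
    ¬((i, j) ∈ t ∧ (i, j + 1) ∈ t ∧ (i + 1, j) ∈ t ∧ (i + 1, j + 1) ∈ t)

/-- `p` is the starting box of `t`: its bottommost and leftmost box. -/
def IsStartBox (t : Finset (ℤ × ℤ)) (p : ℤ × ℤ) : Prop :=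
  p ∈ t ∧ ∀ q ∈ t, q.1 ≤ p.1 ∧ p.2 ≤ q.2

/-- `p` is the ending box of `t`: its topmost and rightmost box. -/
def IsEndBox (t : Finset (ℤ × ℤ)) (p : ℤ × ℤ) : Prop :=
  p ∈ t ∧ ∀ q ∈ t, p.1 ≤ q.1 ∧ q.2 ≤ p.2

/-- An outside decomposition of a diagram `D` into `r` strips. The starting and ending
boxes are determined by the strips. -/
structure OutsideDecomposition (D : Finset (ℤ × ℤ)) (r : ℕ) where
  strip : Fin r → Finset (ℤ × ℤ)
  isStrip : ∀ i, IsStrip (strip i)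
  /-- the starting box of each strip -/
  start : Fin r → ℤ × ℤ
  isStartBox : ∀ i, IsStartBox (strip i) (start i)
  /-- the starting box lies on the left or bottom perimeter of `D` -/
  start_perimeter : ∀ i, leftOf (start i) ∉ D ∨ below (start i) ∉ D
  /-- the ending box of each strip -/
  finish : Fin r → ℤ × ℤ
  isEndBox : ∀ i, IsEndBox (strip i) (finish i)
  /-- the ending box lies on the right or top perimeter of `D` -/
  finish_perimeter : ∀ i, rightOf (finish i) ∉ D ∨ above (finish i) ∉ D
  disjoint : ∀ i j, i ≠ j → Disjoint (strip i) (strip j)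
  union : Finset.univ.biUnion strip = D

/-- The two directions from which a box of a strip can be approached. -/
inductive Approach
  | fromLeft
  | fromBelow
deriving DecidableEq

/-- `dir` assigns to each content the direction from which the boxes of that content are
approached in the decomposition: a box preceded in its strip by its left (lower) neighbour
is approached from the left (from below); a starting box is approached from the left if it
lies on the left perimeter of `D`, and from below if it lies on the bottom perimeter.
At a content of which `D` has no box, `dir` is an arbitrary fixed choice. -/
def OutsideDecomposition.IsApproach {D : Finset (ℤ × ℤ)} {r : ℕ}
    (d : OutsideDecomposition D r) (dir : ℤ → Approach) : Prop :=
  ∀ i, ∀ p ∈ d.strip i,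
    (leftOf p ∈ d.strip i → dir (content p) = .fromLeft) ∧
    (below p ∈ d.strip i → dir (content p) = .fromBelow) ∧
    (p = d.start i →
      (leftOf p ∉ D ∧ dir (content p) = .fromLeft) ∨
      (below p ∉ D ∧ dir (content p) = .fromBelow))

/-- The box of content `c` on the path of boxes which starts at `p` and goes on to the
right or upwards, each further box being approached as `dir` prescribes for its content. -/
noncomputable def pathBox (dir : ℤ → Approach) (p : ℤ × ℤ) (c : ℤ) : ℤ × ℤ :=
  let up : ℤ := ((Finset.Ioc (content p) c).filter fun k => dir k = .fromBelow).card
  (p.1 - up, p.1 - up + c)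

/-- The diagram of `θ_i # θ_j`: all boxes from the starting box of `θ_j` up to the content
of the ending box of `θ_i`. It is empty if the latter content is smaller than the former. -/
noncomputable def OutsideDecomposition.join {D : Finset (ℤ × ℤ)} {r : ℕ} (d : OutsideDecomposition D r)
    (dir : ℤ → Approach) (i j : Fin r) : Finset (ℤ × ℤ) :=
  (Finset.Icc (content (d.start j)) (content (d.finish i))).image (pathBox dir (d.start j))

/-- `θ_i # θ_j` is undefined: the ending box of `θ_i` occurs before the starting box of
`θ_j`, and there is a gap between the two. -/
def OutsideDecomposition.JoinUndefined {D : Finset (ℤ × ℤ)} {r : ℕ}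
    (d : OutsideDecomposition D r) (i j : Fin r) : Prop :=
  content (d.finish i) + 1 < content (d.start j)

/-- The set `T(D, X)` of fillings of the boxes of `D` with elements of `X`. -/
abbrev Tableau (D : Finset (ℤ × ℤ)) (X : Type*) := {p : ℤ × ℤ // p ∈ D} → X

/-- The set `T^diag(D, X)`: the entries are constant on the diagonals. -/
def IsDiagonal {D : Finset (ℤ × ℤ)} {X : Type*} (s : Tableau D X) : Prop :=
  ∀ p q : {p : ℤ × ℤ // p ∈ D}, content p = content q → s p = s q

/-- The filling of `D` in which each box of content `c` contains `a c`. -/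
def contentTableau {X : Type*} (a : ℤ → X) (D : Finset (ℤ × ℤ)) : Tableau D X :=
  fun p => a (content p)

/-- The alphabet `1 < 1̄ < 2 < 2̄ < ⋯ < N < N̄`: the pair `(k, false)` is the letter
`k + 1` and the pair `(k, true)` is the barred letter `k + 1`. -/
abbrev Letter (N : ℕ) := Fin N ×ₗ Bool

/-- The number `i` of the letter `i` or `ī`. -/
def Letter.number {N : ℕ} (x : Letter N) : ℕ := ((ofLex x).1 : ℕ) + 1

/-- `|i| = i` and `|ī| = i⁻¹`. -/
noncomputable def Letter.abs {N : ℕ} (x : Letter N) : ℝ :=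
  if (ofLex x).2 then (x.number : ℝ)⁻¹ else (x.number : ℝ)

/-- Symplectic tableaux on a diagram: weakly increasing rows, strictly increasing columns,
and the boxes of content `-i` contain entries `≥ i + 1` (a letter is `≥` the letter
`i + 1` if and only if its number is). -/
structure IsSymplectic {D : Finset (ℤ × ℤ)} {N : ℕ} (T : Tableau D (Letter N)) : Prop where
  row : ∀ p q : {p : ℤ × ℤ // p ∈ D}, p.1.1 = q.1.1 → p.1.2 ≤ q.1.2 → T p ≤ T q
  col : ∀ p q : {p : ℤ × ℤ // p ∈ D}, p.1.2 = q.1.2 → p.1.1 < q.1.1 → T p < T q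
  symplectic : ∀ p : {p : ℤ × ℤ // p ∈ D}, -content p + 1 ≤ ((T p).number : ℤ)

open Classical in
/-- The symplectic Schur multiple zeta function `∑_M 1 / M^s` of the diagram `D`, the sum
being over the symplectic tableaux with letters `1, 1̄, …, N, N̄`, with
`M^s = ∏ |m_ij|^(s_ij)`. -/
noncomputable def zeta (N : ℕ) (D : Finset (ℤ × ℤ)) (s : Tableau D ℂ) : ℂ :=
  ∑ M ∈ (Finset.univ : Finset (Tableau D (Letter N))).filter IsSymplectic,
    1 / ∏ p, (((M p).abs : ℝ) : ℂ) ^ s p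

open Classical in
/-- The zeta function of `θ_i # θ_j` with the variables `a c` in the boxes of content `c`;
it is `0` if `θ_i # θ_j` is undefined. -/
noncomputable def OutsideDecomposition.joinZeta (N : ℕ) {D : Finset (ℤ × ℤ)} {r : ℕ}
    (d : OutsideDecomposition D r) (dir : ℤ → Approach) (a : ℤ → ℂ) (i j : Fin r) : ℂ :=
  if d.JoinUndefined i j then 0 else zeta N (d.join dir i j) (contentTableau a _)

end SpZeta

/-! Both sides count semistandard fillings with weights that depend only on the entry and on the
content of its box; the symplectic condition is absorbed by giving forbidden entries weight zero
(`zeta_eq_sum`). `IsPathDecomposition.sum_eq_det` proves the identity for arbitrary such weights by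
sweeping across the diagonals, without an involution.

For a content `k`, sum over the fillings of the boxes of content at least `k` the weight of the
boxes beyond diagonal `k` times the determinant of `sweepMatrix`. Row `i` of this matrix is a unit
vector as long as path `i` has not begun, counts the partial joined paths with prescribed last entry
while path `i` runs, and is the final row once it has ended. Far to the left the matrix is the
identity and the sum is the tableau sum; far to the right only the final determinant is left. So it
is enough that the sum does not depend on `k` (`sweep_eq_sweep_add_one`).

With diagonal `k + 1` given, the entries of diagonal `k` can be chosen independently, and
multilinearity moves the sum into the rows. An entry must satisfy one relation with its successor on
the path and violate the same relation with its other neighbour in diagonal `k + 1`. By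
`follows_of_other` the relation with the latter implies that with the former, so each such row is a
difference of two rows for `k + 1`: a row operation of determinant one (`det_sum_allowed`).

A nonempty joined strip is itself decomposed into one path, so the same theorem evaluates the matrix
entries. Directions exist because, for diagonally adjacent boxes, the box between them at the lower
left cannot be an ending box, and its successor decides how one of the two is approached
(`not_fromBelow_diagNext`). -/

namespace SpZeta

open Finset

/-! ### Boxes and paths -/

/-- The box that follows `p` on a path whose next content is approached from `a`. -/
def nextBox : Approach → ℤ × ℤ → ℤ × ℤ
  | .fromLeft, p => rightOf p
  | .fromBelow, p => above p

/-- The neighbour of `p` in the next diagonal that is not `nextBox a p`. -/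
def otherBox : Approach → ℤ × ℤ → ℤ × ℤ
  | .fromLeft, p => above p
  | .fromBelow, p => rightOf p

/-- The box from which `p` is approached. -/
def prevBox : Approach → ℤ × ℤ → ℤ × ℤ
  | .fromLeft, p => leftOf p
  | .fromBelow, p => below p

/-- The condition on the entries of a box and its successor on a path. -/
def Follows {X : Type*} [LinearOrder X] : Approach → X → X → Prop
  | .fromLeft, x, y => x ≤ y
  | .fromBelow, x, y => y < x

theorem content_nextBox (a : Approach) (p : ℤ × ℤ) : content (nextBox a p) = content p + 1 := by
  cases a <;> simp [nextBox, content, rightOf, above] <;> ring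

theorem content_otherBox (a : Approach) (p : ℤ × ℤ) : content (otherBox a p) = content p + 1 := by
  cases a <;> simp [otherBox, content, rightOf, above] <;> ring

theorem prevBox_nextBox (a : Approach) (p : ℤ × ℤ) : prevBox a (nextBox a p) = p := by
  cases a <;> simp [nextBox, prevBox, rightOf, above, leftOf, below]

theorem nextBox_prevBox (a : Approach) (p : ℤ × ℤ) : nextBox a (prevBox a p) = p := by
  cases a <;> simp [nextBox, prevBox, rightOf, above, leftOf, below]

theorem content_pathBox (dir : ℤ → Approach) (p : ℤ × ℤ) (c : ℤ) :
    content (pathBox dir p c) = c := by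
  simp [pathBox, content]

theorem pathBox_content (dir : ℤ → Approach) (p : ℤ × ℤ) : pathBox dir p (content p) = p := by
  simp [pathBox, content]

theorem pathBox_add_one (dir : ℤ → Approach) (p : ℤ × ℤ) {k : ℤ} (hk : content p ≤ k) :
    pathBox dir p (k + 1) = nextBox (dir (k + 1)) (pathBox dir p k) := by
  have h : Ioc (content p) (k + 1) = insert (k + 1) (Ioc (content p) k) := by
    ext x; simp only [mem_Ioc, mem_insert]; omega
  have hn : k + 1 ∉ (Ioc (content p) k).filter fun k => dir k = .fromBelow := by simp
  unfold pathBox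
  rw [h, filter_insert]
  cases hd : dir (k + 1)
  · simp [nextBox, rightOf]; ring
  · simp only [if_true, card_insert_of_notMem hn, nextBox, above, Prod.mk.injEq]
    push_cast
    constructor <;> ring

/-! ### Weighted sums over fillings of a path -/

section Chains

variable {X R : Type*} [LinearOrder X] [Fintype X] [CommRing R]

open Classical in
/-- The weighted number of fillings of a path of `n + 1` boxes starting at content `c` with
last entry `x`. -/
noncomputable def chain (w : ℤ → X → R) (dir : ℤ → Approach) (c : ℤ) : ℕ → X → R
  | 0, x => w c x
  | n + 1, x => w (c + n + 1) x *
      ∑ z with Follows (dir (c + n + 1)) z x, chain w dir c n z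

/-- The weighted number of fillings of the path from content `c` to content `k` with last
entry `x`. -/
noncomputable def pathSumTo (w : ℤ → X → R) (dir : ℤ → Approach) (c k : ℤ) (x : X) : R :=
  if c ≤ k then chain w dir c (k - c).toNat x else 0

/-- The weighted number of fillings of the path from content `c` to content `d`. -/
noncomputable def pathSum (w : ℤ → X → R) (dir : ℤ → Approach) (c d : ℤ) : R :=
  ∑ x, pathSumTo w dir c d x + if c = d + 1 then 1 else 0

-- The indicator is the empty path, which seeds the recursion at the starting content. With it one
-- formula covers paths that are running, just starting, or not yet begun.
open Classical in
theorem pathSumTo_add_one (w : ℤ → X → R) (dir : ℤ → Approach) (c k : ℤ) (x : X) :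
    pathSumTo w dir c (k + 1) x = w (k + 1) x *
      (∑ z with Follows (dir (k + 1)) z x, pathSumTo w dir c k z +
        if c = k + 1 then 1 else 0) := by
  rcases lt_trichotomy c (k + 1) with h | h | h
  · have h1 : c ≤ k := by omega
    obtain ⟨n, rfl⟩ := Int.le.dest h1
    have h2 : (c + n + 1 - c).toNat = n + 1 := by omega
    have h3 : (c + (n : ℤ) - c).toNat = n := by omega
    simp only [pathSumTo, if_pos h.le, if_pos h1, if_neg h.ne, add_zero, h2, h3, chain]
  · subst h
    simp [pathSumTo, chain]
  · have h1 : ¬ c ≤ k + 1 := by omega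
    have h2 : ¬ c ≤ k := by omega
    simp [pathSumTo, h1, h2, h.ne']

theorem pathSum_eq_zero (w : ℤ → X → R) (dir : ℤ → Approach) {c d : ℤ} (h : d + 1 < c) :
    pathSum w dir c d = 0 := by
  have h1 : ¬ c ≤ d := by omega
  simp [pathSum, pathSumTo, h1, h.ne']

theorem pathSum_eq_one (w : ℤ → X → R) (dir : ℤ → Approach) {c d : ℤ} (h : c = d + 1) :
    pathSum w dir c d = 1 := by
  simp [pathSum, pathSumTo, h]

end Chains

/-! ### Determinant lemmas -/

section Determinants

variable {ι R : Type*} [Fintype ι] [DecidableEq ι] [CommRing R]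

/-- Ordered by decreasing rank, `P` is strictly triangular. Ranks may coincide, hence the block
form, with identity matrices as diagonal blocks. -/
theorem det_one_sub_of_rank_lt (P : Matrix ι ι R) (ρ : ι → ℤ)
    (h : ∀ i j, P i j ≠ 0 → ρ j < ρ i) : (1 - P).det = 1 := by
  have h0 : ∀ i j, ρ i ≤ ρ j → P i j = 0 := fun i j hij => by
    by_contra hne; exact absurd (h i j hne) (not_lt.2 hij)
  have hb : (1 - P).BlockTriangular (fun i => -ρ i) := by
    intro i j hij
    have hij : ρ i < ρ j := by simpa using hij
    have hne : i ≠ j := by rintro rfl; exact lt_irrefl _ hij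
    simp [Matrix.one_apply_ne hne, h0 i j hij.le]
  rw [hb.det]
  refine prod_eq_one fun a _ => ?_
  have : (1 - P).toSquareBlock (fun i => -ρ i) a = 1 := by
    ext ⟨i, hi⟩ ⟨j, hj⟩
    have : ρ i ≤ ρ j := by omega
    simp [Matrix.toSquareBlock, Matrix.toSquareBlockProp, h0 i j this, Matrix.one_apply]
  rw [this, Matrix.det_one]

/-- If column `i` of `A` is a unit vector, the other entries of row `i` do not matter. -/
theorem det_eq_of_column_eq_single (A B : Matrix ι ι R) (i : ι)
    (hA : ∀ l, A l i = if l = i then 1 else 0) (hB : B i i = 1)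
    (hAB : ∀ l, l ≠ i → A l = B l) : A.det = B.det := by
  have h1 : B = A.updateRow i (A i + (B i - A i)) := by
    ext l j
    by_cases hl : l = i
    · subst hl; simp
    · rw [Matrix.updateRow_ne hl, hAB l hl]
  rw [h1, Matrix.det_updateRow_add, Matrix.updateRow_eq_self]
  -- The correction has `B i - A i` in row `i`. Its column `i` vanishes because `A` and `B` agree at
  -- the diagonal entry.
  rw [Matrix.det_eq_zero_of_column_eq_zero (A := A.updateRow i (B i - A i)) i, add_zero]
  intro l
  by_cases hl : l = i
  · subst hl; simp [hA, hB]
  · rw [Matrix.updateRow_ne hl, hA, if_neg hl]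

/-- Multilinearity in the rows: row `i` depends only on the choice `x i`. -/
theorem sum_piFinset_det {X : Type*} [DecidableEq X] (S : ι → Finset X) (f : ι → X → ι → R) :
    ∑ x ∈ Fintype.piFinset S, Matrix.det (Matrix.of fun i => f i (x i)) =
      Matrix.det (Matrix.of fun i j => ∑ x ∈ S i, f i x j) := by
  have h := (Matrix.detRowAlternating (n := ι) (R := R)).toMultilinearMap.map_sum_finset f S
  have h2 : (fun i => ∑ x ∈ S i, f i x) = (fun i j => ∑ x ∈ S i, f i x j) := by
    ext i j; simp
  rw [h2] at h
  exact h.symm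

end Determinants

/-! ### Decompositions of a convex diagram into paths -/

section Decomposition

variable {ι : Type*}

/-- The `i`-th path, which begins at `start i`, has a box of content `k`. -/
def HasContent (start : ι → ℤ × ℤ) (last : ι → ℤ) (i : ι) (k : ℤ) : Prop :=
  content (start i) ≤ k ∧ k ≤ last i

/-- `D` is a convex set of boxes and the disjoint union of the paths which begin at `start i`,
follow the directions `dir`, and have an ending box of content `last i`. -/
structure IsPathDecomposition (D : Finset (ℤ × ℤ)) (dir : ℤ → Approach)
    (start : ι → ℤ × ℤ) (last : ι → ℤ) : Prop where
  convex : ∀ p ∈ D, ∀ q ∈ D, ∀ m, p ≤ m → m ≤ q → m ∈ D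
  start_le_last : ∀ i, content (start i) ≤ last i
  mem_iff : ∀ p, p ∈ D ↔
    ∃ i, HasContent start last i (content p) ∧ pathBox dir (start i) (content p) = p
  injective : ∀ i j k, HasContent start last i k → HasContent start last j k →
    pathBox dir (start i) k = pathBox dir (start j) k → i = j
  prevBox_start : ∀ i, prevBox (dir (content (start i))) (start i) ∉ D
  nextBox_mem : ∀ i k, HasContent start last i k →
    nextBox (dir (k + 1)) (pathBox dir (start i) k) ∈ D → k + 1 ≤ last i

variable {D : Finset (ℤ × ℤ)} {dir : ℤ → Approach} {start : ι → ℤ × ℤ} {last : ι → ℤ}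

theorem IsPathDecomposition.pathBox_mem (h : IsPathDecomposition D dir start last) {i : ι} {k : ℤ}
    (hi : HasContent start last i k) : pathBox dir (start i) k ∈ D :=
  (h.mem_iff _).2 ⟨i, by rwa [content_pathBox], by rw [content_pathBox]⟩

theorem IsPathDecomposition.start_mem (h : IsPathDecomposition D dir start last) (i : ι) :
    start i ∈ D := by
  have := h.pathBox_mem (i := i) (k := content (start i)) ⟨le_rfl, h.start_le_last i⟩
  rwa [pathBox_content] at this

theorem IsPathDecomposition.prevBox_start_of_eq (h : IsPathDecomposition D dir start last)
    {i : ι} {k : ℤ} (hi : content (start i) = k) : prevBox (dir k) (start i) ∉ D :=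
  hi ▸ h.prevBox_start i

/-- Of two distinct starting boxes on one diagonal, the lower has its left neighbour, and the upper
its lower neighbour, in the rectangle they span. Convexity puts that neighbour in `D`, against
`prevBox_start`. -/
theorem IsPathDecomposition.start_injective (h : IsPathDecomposition D dir start last) {i j : ι}
    (hij : content (start i) = content (start j)) : i = j := by
  have hi := h.start_mem i
  have hj := h.start_mem j
  have pi := h.prevBox_start_of_eq hij
  have pj := h.prevBox_start j
  refine h.injective i j (content (start j)) ⟨hij.le, hij ▸ h.start_le_last i⟩
    ⟨le_rfl, h.start_le_last j⟩ ?_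
  rw [pathBox_content, ← hij, pathBox_content]
  rw [← hij] at pi pj
  generalize start i = p at *
  generalize start j = q at *
  obtain ⟨p1, p2⟩ := p
  obtain ⟨q1, q2⟩ := q
  simp only [content] at hij
  by_contra hne
  have hne : p1 ≠ q1 := by
    rintro rfl; exact hne (by rw [Prod.mk.injEq]; omega)
  cases hd : dir (content (p1, p2)) <;>
    simp only [hd, prevBox, leftOf, below] at pi pj <;>
    rcases lt_or_gt_of_ne hne with hlt | hlt
  · exact pj (h.convex _ hi _ hj _ (by simp only [Prod.mk_le_mk]; omega)
      (by simp only [Prod.mk_le_mk]; omega))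
  · exact pi (h.convex _ hj _ hi _ (by simp only [Prod.mk_le_mk]; omega)
      (by simp only [Prod.mk_le_mk]; omega))
  · exact pi (h.convex _ hi _ hj _ (by simp only [Prod.mk_le_mk]; omega)
      (by simp only [Prod.mk_le_mk]; omega))
  · exact pj (h.convex _ hj _ hi _ (by simp only [Prod.mk_le_mk]; omega)
      (by simp only [Prod.mk_le_mk]; omega))

/-- A start on diagonal `k + 1` together with the box of content `k` spans a rectangle that contains
either the box before the start or the other neighbour; neither lies in `D`. -/
theorem IsPathDecomposition.content_start_ne (h : IsPathDecomposition D dir start last) {i : ι}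
    {k : ℤ} (hi : HasContent start last i k)
    (ho : otherBox (dir (k + 1)) (pathBox dir (start i) k) ∉ D) (j : ι) :
    content (start j) ≠ k + 1 := by
  intro hj
  have hb := h.pathBox_mem hi
  have hq := h.start_mem j
  have hpq := h.prevBox_start_of_eq hj
  have hn := h.nextBox_mem i k hi
  have hc := content_pathBox dir (start i) k
  generalize pathBox dir (start i) k = b at *
  generalize start j = q at *
  obtain ⟨b1, b2⟩ := b
  obtain ⟨q1, q2⟩ := q
  simp only [content] at hc hj
  cases hd : dir (k + 1) <;>
    simp only [hd, prevBox, otherBox, leftOf, rightOf, above, below] at ho hpq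
  · rcases le_or_gt b1 q1 with hlt | hlt
    · exact hpq (h.convex _ hb _ hq _ (by simp only [Prod.mk_le_mk]; omega)
        (by simp only [Prod.mk_le_mk]; omega))
    · exact ho (h.convex _ hq _ hb _ (by simp only [Prod.mk_le_mk]; omega)
        (by simp only [Prod.mk_le_mk]; omega))
  · rcases le_or_gt b1 q1 with hlt | hlt
    · exact ho (h.convex _ hb _ hq _ (by simp only [Prod.mk_le_mk]; omega)
        (by simp only [Prod.mk_le_mk]; omega))
    · exact hpq (h.convex _ hq _ hb _ (by simp only [Prod.mk_le_mk]; omega)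
        (by simp only [Prod.mk_le_mk]; omega))

/-- The path which contains a given box. -/
noncomputable def IsPathDecomposition.pathOf (h : IsPathDecomposition D dir start last)
    (p : {p : ℤ × ℤ // p ∈ D}) : ι :=
  ((h.mem_iff p).1 p.2).choose

theorem IsPathDecomposition.hasContent_pathOf (h : IsPathDecomposition D dir start last)
    (p : {p : ℤ × ℤ // p ∈ D}) : HasContent start last (h.pathOf p) (content p) :=
  ((h.mem_iff p).1 p.2).choose_spec.1

theorem IsPathDecomposition.pathBox_pathOf (h : IsPathDecomposition D dir start last)
    (p : {p : ℤ × ℤ // p ∈ D}) : pathBox dir (start (h.pathOf p)) (content p) = p :=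
  ((h.mem_iff p).1 p.2).choose_spec.2

theorem IsPathDecomposition.pathOf_eq (h : IsPathDecomposition D dir start last)
    {p : {p : ℤ × ℤ // p ∈ D}} {i : ι} {k : ℤ} (hi : HasContent start last i k)
    (hp : pathBox dir (start i) k = p) : h.pathOf p = i := by
  obtain rfl : k = content p := by rw [← hp, content_pathBox]
  exact h.injective _ _ _ (h.hasContent_pathOf p) hi (by rw [h.pathBox_pathOf, hp])

end Decomposition

/-! ### Fillings built one diagonal at a time -/

section Tableaux

variable {X : Type*} [LinearOrder X] {D : Finset (ℤ × ℤ)}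

/-- The extension of a filling of `D` to all boxes by the letter `x₀`. -/
def extendTableau (x₀ : X) (T : Tableau D X) (p : ℤ × ℤ) : X :=
  if h : p ∈ D then T ⟨p, h⟩ else x₀

theorem extendTableau_of_mem (x₀ : X) (T : Tableau D X) {p : ℤ × ℤ} (h : p ∈ D) :
    extendTableau x₀ T p = T ⟨p, h⟩ := dif_pos h

/-- The conditions on a semistandard filling which compare the box `p` with its neighbours in
the next diagonal. -/
def LocalCond (D : Finset (ℤ × ℤ)) (v : ℤ × ℤ → X) (p : ℤ × ℤ) : Prop :=
  (rightOf p ∈ D → v p ≤ v (rightOf p)) ∧ (above p ∈ D → v (above p) < v p)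

/-- Weak increase to the right and strict decrease upwards are complementary: each is the negation
of the relation `Follows` belonging to the other direction. -/
theorem localCond_iff (a : Approach) (v : ℤ × ℤ → X) (p : ℤ × ℤ) :
    LocalCond D v p ↔ (nextBox a p ∈ D → Follows a (v p) (v (nextBox a p))) ∧
      (otherBox a p ∈ D → ¬ Follows a (v p) (v (otherBox a p))) := by
  cases a <;> simp [LocalCond, nextBox, otherBox, Follows, and_comm]

theorem LocalCond.congr {v v' : ℤ × ℤ → X} {p : ℤ × ℤ} (h : LocalCond D v p)
    (hv : ∀ q ∈ D, content p ≤ content q → v q = v' q) (hp : p ∈ D) : LocalCond D v' p := by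
  have hr : content p ≤ content (rightOf p) := by simp [content, rightOf]
  have ha : content p ≤ content (above p) := by simp [content, above]; omega
  refine ⟨fun hm => ?_, fun hm => ?_⟩
  · rw [← hv _ hm hr, ← hv p hp le_rfl]; exact h.1 hm
  · rw [← hv _ hm ha, ← hv p hp le_rfl]; exact h.2 hm

variable [Fintype X]

open Classical in
/-- The semistandard fillings of the boxes of content at least `k`, extended by `x₀`. -/
noncomputable def partialTableaux (D : Finset (ℤ × ℤ)) (x₀ : X) (k : ℤ) :
    Finset (Tableau D X) :=
  univ.filter fun T => (∀ p, content p.1 < k → T p = x₀) ∧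
    ∀ p ∈ D, k ≤ content p → LocalCond D (extendTableau x₀ T) p

theorem mem_partialTableaux {x₀ : X} {k : ℤ} {T : Tableau D X} :
    T ∈ partialTableaux D x₀ k ↔ (∀ p, content p.1 < k → T p = x₀) ∧
      ∀ p ∈ D, k ≤ content p → LocalCond D (extendTableau x₀ T) p := by
  simp [partialTableaux]

variable {ι : Type*} {dir : ℤ → Approach} {start : ι → ℤ × ℤ} {last : ι → ℤ}

open Classical in
/-- The letters that the box of content `k` of the `i`-th path may contain, given the entries
of the boxes of larger content. -/
noncomputable def allowed (D : Finset (ℤ × ℤ)) (dir : ℤ → Approach) (start : ι → ℤ × ℤ)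
    (last : ι → ℤ) (x₀ : X) (k : ℤ) (T : Tableau D X) (i : ι) : Finset X :=
  if HasContent start last i k then
    univ.filter fun x =>
      (nextBox (dir (k + 1)) (pathBox dir (start i) k) ∈ D → Follows (dir (k + 1)) x
        (extendTableau x₀ T (nextBox (dir (k + 1)) (pathBox dir (start i) k)))) ∧
      (otherBox (dir (k + 1)) (pathBox dir (start i) k) ∈ D → ¬ Follows (dir (k + 1)) x
        (extendTableau x₀ T (otherBox (dir (k + 1)) (pathBox dir (start i) k))))
  else {x₀}

/-- The filling `T` with the entries of content `k` replaced by those of `x`. -/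
noncomputable def IsPathDecomposition.setDiagonal (h : IsPathDecomposition D dir start last)
    (k : ℤ) (T : Tableau D X) (x : ι → X) : Tableau D X :=
  fun p => if content p.1 = k then x (h.pathOf p) else T p

theorem IsPathDecomposition.extend_setDiagonal_of_ne (h : IsPathDecomposition D dir start last)
    (x₀ : X) {k : ℤ} (T : Tableau D X) (x : ι → X) {p : ℤ × ℤ} (hp : content p ≠ k) :
    extendTableau x₀ (h.setDiagonal k T x) p = extendTableau x₀ T p := by
  simp [extendTableau, setDiagonal, hp]

theorem IsPathDecomposition.extend_setDiagonal_pathBox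
    (h : IsPathDecomposition D dir start last)
    (x₀ : X) {k : ℤ} (T : Tableau D X) (x : ι → X) {i : ι} (hi : HasContent start last i k) :
    extendTableau x₀ (h.setDiagonal k T x) (pathBox dir (start i) k) = x i := by
  rw [extendTableau_of_mem _ _ (h.pathBox_mem hi)]
  simp only [setDiagonal, content_pathBox, if_true]
  rw [h.pathOf_eq (p := ⟨_, h.pathBox_mem hi⟩) hi rfl]

theorem IsPathDecomposition.extend_reset (x₀ : X) {k : ℤ} (T : Tableau D X) {p : ℤ × ℤ}
    (hp : content p ≠ k) :
    extendTableau x₀ (fun p : {p : ℤ × ℤ // p ∈ D} => if content p.1 = k then x₀ else T p) p =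
      extendTableau x₀ T p := by
  simp [extendTableau, hp]

-- The local condition at a box of content `k` involves only that box and diagonal `k + 1`, so the
-- choices on diagonal `k` are independent. A path without a box there has the single dummy choice
-- `x₀`, which keeps the correspondence bijective.
open Classical in
theorem IsPathDecomposition.sum_partialTableaux [Fintype ι] {R : Type*} [AddCommMonoid R]
    (h : IsPathDecomposition D dir start last) (x₀ : X) (k : ℤ) (f : Tableau D X → R) :
    ∑ T ∈ partialTableaux D x₀ k, f T =
      ∑ T ∈ partialTableaux D x₀ (k + 1),
        ∑ x ∈ Fintype.piFinset (allowed D dir start last x₀ k T),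
          f (h.setDiagonal k T x) := by
  have hcn : ∀ (i : ι), content (nextBox (dir (k + 1)) (pathBox dir (start i) k)) ≠ k :=
    fun i => by rw [content_nextBox, content_pathBox]; omega
  have hco : ∀ (i : ι), content (otherBox (dir (k + 1)) (pathBox dir (start i) k)) ≠ k :=
    fun i => by rw [content_otherBox, content_pathBox]; omega
  have hleft : ∀ T : Tableau D X, h.setDiagonal k
      (fun p : {p : ℤ × ℤ // p ∈ D} => if content p.1 = k then x₀ else T p)
      (fun i => if HasContent start last i k then
        extendTableau x₀ T (pathBox dir (start i) k) else x₀) = T := by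
    intro T
    funext p
    simp only [setDiagonal]
    by_cases hp : content p.1 = k
    · have h1 := h.hasContent_pathOf p
      have h2 := h.pathBox_pathOf p
      rw [hp] at h1 h2
      rw [if_pos hp, if_pos h1, h2, extendTableau_of_mem _ _ p.2]
    · rw [if_neg hp, if_neg hp]
  rw [sum_sigma']
  refine sum_bij' (fun T _ => ⟨fun p => if content p.1 = k then x₀ else T p,
      fun i => if HasContent start last i k then
        extendTableau x₀ T (pathBox dir (start i) k) else x₀⟩)
    (fun z _ => h.setDiagonal k z.1 z.2) ?_ ?_ ?_ ?_ ?_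
  · intro T hT
    rw [mem_partialTableaux] at hT
    rw [mem_sigma, mem_partialTableaux, Fintype.mem_piFinset]
    refine ⟨⟨fun p hp => ?_, fun p hp hk => ?_⟩, fun i => ?_⟩
    · dsimp only
      split_ifs with hpk
      · rfl
      · exact hT.1 p (by omega)
    · refine (hT.2 p hp (by omega)).congr (fun q _ hq => ?_) hp
      exact (extend_reset x₀ T (by omega)).symm
    · by_cases hi : HasContent start last i k
      · have := (localCond_iff (dir (k + 1)) _ _).1
          (hT.2 _ (h.pathBox_mem hi) (by rw [content_pathBox]))
        simp only [allowed, if_pos hi, mem_filter, mem_univ, true_and]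
        rwa [extend_reset x₀ T (hcn i), extend_reset x₀ T (hco i)]
      · simp [allowed, if_neg hi]
  · rintro ⟨T, x⟩ hz
    rw [mem_sigma, mem_partialTableaux, Fintype.mem_piFinset] at hz
    obtain ⟨⟨hT1, hT2⟩, hx⟩ := hz
    dsimp only at hT1 hT2 hx ⊢
    rw [mem_partialTableaux]
    refine ⟨fun p hp => ?_, fun p hp hk => ?_⟩
    · rw [setDiagonal, if_neg hp.ne]
      exact hT1 p (by omega)
    · by_cases hpk : content p = k
      · obtain ⟨i, hi, hb⟩ := (h.mem_iff p).1 hp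
        rw [hpk] at hi hb
        have := hx i
        simp only [allowed, if_pos hi, mem_filter, mem_univ, true_and] at this
        rw [localCond_iff (dir (k + 1)), ← hb, h.extend_setDiagonal_pathBox x₀ T x hi,
          h.extend_setDiagonal_of_ne x₀ T x (hcn i), h.extend_setDiagonal_of_ne x₀ T x (hco i)]
        exact this
      · refine (hT2 p hp (by omega)).congr (fun q _ hq => ?_) hp
        exact (h.extend_setDiagonal_of_ne x₀ T x (by omega)).symm
  · intro T _
    exact hleft T
  · rintro ⟨T, x⟩ hz
    rw [mem_sigma, mem_partialTableaux, Fintype.mem_piFinset] at hz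
    obtain ⟨⟨hT1, hT2⟩, hx⟩ := hz
    dsimp only at hT1 hT2 hx ⊢
    congr 1
    · funext p
      split_ifs with hp
      · exact (hT1 p (by omega)).symm
      · rw [setDiagonal, if_neg hp]
    · funext i
      split_ifs with hi
      · exact h.extend_setDiagonal_pathBox x₀ T x hi
      · have := hx i
        rw [allowed, if_neg hi, mem_singleton] at this
        exact this.symm
  · intro T _
    rw [hleft]

end Tableaux

/-! ### The determinant swept across the diagonals -/

section Sweep

variable {X R ι : Type*} [LinearOrder X] [Fintype X] [CommRing R]
  {D : Finset (ℤ × ℤ)} {dir : ℤ → Approach} {start : ι → ℤ × ℤ} {last : ι → ℤ}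

/-- Row `i` of the matrix in `sweepMatrix`, with `x` in the box of content `k`. -/
noncomputable def sweepRow [DecidableEq ι] (w : ℤ → X → R) (dir : ℤ → Approach)
    (start : ι → ℤ × ℤ) (last : ι → ℤ) (k : ℤ) (i : ι) (x : X) (j : ι) : R :=
  if last i < k then pathSum w dir (content (start j)) (last i)
  else if k < content (start i) then (if i = j then 1 else 0)
  else pathSumTo w dir (content (start j)) k x

/-- The matrix whose determinant counts the fillings of the boxes of content at most `k`
when the box of content `k` of path `i` contains `y i`. -/
noncomputable def sweepMatrix [DecidableEq ι] (w : ℤ → X → R) (dir : ℤ → Approach)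
    (start : ι → ℤ × ℤ) (last : ι → ℤ) (k : ℤ) (y : ι → X) : Matrix ι ι R :=
  Matrix.of fun i => sweepRow w dir start last k i (y i)

open Classical in
/-- The matrix in `sweepMatrix` for content `k + 1`, without the weights of the boxes of
content `k + 1`. -/
noncomputable def nextMatrix (w : ℤ → X → R) (dir : ℤ → Approach)
    (start : ι → ℤ × ℤ) (last : ι → ℤ) (k : ℤ) (y : ι → X) : Matrix ι ι R :=
  Matrix.of fun i j =>
    if last i < k + 1 then pathSum w dir (content (start j)) (last i)
    else if k + 1 < content (start i) then (if i = j then 1 else 0)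
    else ∑ z with Follows (dir (k + 1)) z (y i), pathSumTo w dir (content (start j)) k z +
      if content (start j) = k + 1 then 1 else 0

theorem nextMatrix_of_last_lt (w : ℤ → X → R) {k : ℤ} (y : ι → X) {i : ι} (hi : last i < k + 1)
    (j : ι) : nextMatrix w dir start last k y i j = pathSum w dir (content (start j)) (last i) := by
  rw [nextMatrix, Matrix.of_apply, if_pos hi]

open Classical in
theorem nextMatrix_of_lt_start (w : ℤ → X → R) {k : ℤ} (y : ι → X) {i : ι}
    (hi : k + 1 < content (start i)) (hl : content (start i) ≤ last i) (j : ι) :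
    nextMatrix w dir start last k y i j = if i = j then 1 else 0 := by
  rw [nextMatrix, Matrix.of_apply, if_neg (by omega), if_pos hi]

open Classical in
theorem nextMatrix_of_hasContent (w : ℤ → X → R) {k : ℤ} (y : ι → X) {i : ι}
    (hi : HasContent start last i (k + 1)) (j : ι) :
    nextMatrix w dir start last k y i j =
      ∑ z with Follows (dir (k + 1)) z (y i), pathSumTo w dir (content (start j)) k z +
        if content (start j) = k + 1 then 1 else 0 := by
  rw [nextMatrix, Matrix.of_apply, if_neg (not_lt.2 hi.2), if_neg (not_lt.2 hi.1)]

open Classical in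
theorem det_sweepMatrix_add_one [Fintype ι] (w : ℤ → X → R) (k : ℤ) (y : ι → X)
    (hle : ∀ i, content (start i) ≤ last i) :
    (sweepMatrix w dir start last (k + 1) y).det =
      (∏ i, if HasContent start last i (k + 1) then w (k + 1) (y i) else 1) *
        (nextMatrix w dir start last k y).det := by
  rw [← Matrix.det_mul_column]
  congr 1
  ext i j
  have := hle i
  rw [sweepMatrix, Matrix.of_apply, Matrix.of_apply, sweepRow]
  by_cases h1 : last i < k + 1
  · rw [if_pos h1, if_neg (fun hi : HasContent start last i (k + 1) => not_lt.2 hi.2 h1),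
      nextMatrix_of_last_lt w y h1, one_mul]
  · by_cases h2 : k + 1 < content (start i)
    · have hi : ¬ HasContent start last i (k + 1) := fun hi => not_lt.2 hi.1 h2
      rw [if_neg h1, if_pos h2, if_neg hi,
        nextMatrix_of_lt_start w y h2 this, one_mul]
    · have hi : HasContent start last i (k + 1) := ⟨not_lt.1 h2, not_lt.1 h1⟩
      rw [if_neg h1, if_neg h2, if_pos hi, nextMatrix_of_hasContent w y hi, pathSumTo_add_one]

theorem sum_filter_and_not [DecidableEq X] (p q : X → Prop) [DecidablePred p] [DecidablePred q]
    (hqp : ∀ x, q x → p x) (g : X → R) :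
    ∑ x with p x ∧ ¬ q x, g x = ∑ x with p x, g x - ∑ x with q x, g x := by
  rw [eq_sub_iff_add_eq, ← sum_filter_add_sum_filter_not (univ.filter p) q g, add_comm,
    filter_filter, filter_filter]
  congr 2
  ext x
  simpa using hqp x

/-- Two neighbours of a box in the next diagonal have comparable entries. -/
theorem IsPathDecomposition.follows_of_other (h : IsPathDecomposition D dir start last)
    {x₀ : X} {k : ℤ} {T : Tableau D X} (hT : T ∈ partialTableaux D x₀ (k + 1)) (a : Approach)
    {b : ℤ × ℤ} (hb : content b = k) (hn : nextBox a b ∈ D) (ho : otherBox a b ∈ D) {x : X}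
    (hx : Follows a x (extendTableau x₀ T (otherBox a b))) :
    Follows a x (extendTableau x₀ T (nextBox a b)) := by
  have key : ∀ (hr : rightOf b ∈ D) (ha : above b ∈ D),
      extendTableau x₀ T (above b) < extendTableau x₀ T (rightOf b) := by
    intro hr ha
    -- The fourth corner of the `2 × 2` block lies between the two neighbours, and its entry
    -- separates theirs.
    have hc : above (rightOf b) ∈ D := h.convex _ ha _ hr _
      (by simp only [above, rightOf, Prod.mk_le_mk]; omega)
      (by simp only [above, rightOf, Prod.mk_le_mk]; omega)
    rw [mem_partialTableaux] at hT
    have h1 := (hT.2 _ ha (by simp only [content, above] at *; omega)).1 hc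
    have h2 := (hT.2 _ hr (by simp only [content, rightOf] at *; omega)).2 hc
    exact lt_of_le_of_lt h1 h2
  cases a
  · exact le_trans hx (key hn ho).le
  · exact lt_trans (key ho hn) hx

-- The allowed letters are those compatible with the successor minus those related to the other
-- neighbour. The indicators turn both sums into rows of `nextMatrix`; they cancel if the other
-- neighbour is in `D`, and vanish by `content_start_ne` if it is not.
open Classical in
theorem IsPathDecomposition.sum_allowed (h : IsPathDecomposition D dir start last)
    (w : ℤ → X → R) {x₀ : X} {k : ℤ} {T : Tableau D X} (hT : T ∈ partialTableaux D x₀ (k + 1))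
    {i : ι} (hi : HasContent start last i k) (j : ι) :
    ∑ x ∈ allowed D dir start last x₀ k T i, pathSumTo w dir (content (start j)) k x =
      nextMatrix w dir start last k
          (fun i => extendTableau x₀ T (pathBox dir (start i) (k + 1))) i j -
        if otherBox (dir (k + 1)) (pathBox dir (start i) k) ∈ D then
          ∑ z with Follows (dir (k + 1)) z
              (extendTableau x₀ T (otherBox (dir (k + 1)) (pathBox dir (start i) k))),
            pathSumTo w dir (content (start j)) k z +
              if content (start j) = k + 1 then 1 else 0
        else 0 := by
  have hnext := pathBox_add_one dir (start i) hi.1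
  have hc := content_pathBox dir (start i) k
  have hmem := h.nextBox_mem i k hi
  have h0 := fun ho => h.content_start_ne (i := i) (k := k) hi ho j
  have hmem' : k + 1 ≤ last i → nextBox (dir (k + 1)) (pathBox dir (start i) k) ∈ D := by
    intro hl
    rw [← hnext]
    exact h.pathBox_mem ⟨by have := hi.1; omega, hl⟩
  have hfol := fun x => h.follows_of_other hT (dir (k + 1)) hc (x := x)
  have hlast := nextMatrix_of_last_lt (dir := dir) (start := start) w (k := k) (i := i) (last := last)
    (fun i => extendTableau x₀ T (pathBox dir (start i) (k + 1))) (j := j)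
  have hhas : k + 1 ≤ last i → _ := fun hl => nextMatrix_of_hasContent (dir := dir) w
    (fun i => extendTableau x₀ T (pathBox dir (start i) (k + 1)))
    (i := i) (start := start) (last := last) ⟨by have := hi.1; omega, hl⟩ j
  simp only [allowed, if_pos hi, hnext] at hhas ⊢
  generalize pathBox dir (start i) k = b at *
  have e := sum_filter_and_not
    (fun x => nextBox (dir (k + 1)) b ∈ D →
      Follows (dir (k + 1)) x (extendTableau x₀ T (nextBox (dir (k + 1)) b)))
    (fun x => otherBox (dir (k + 1)) b ∈ D ∧
      Follows (dir (k + 1)) x (extendTableau x₀ T (otherBox (dir (k + 1)) b)))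
    (fun x hx hn => hfol x hn hx.1 hx.2) (pathSumTo w dir (content (start j)) k)
  simp only [not_and] at e
  rw [e]
  have e2 : ∑ x with nextBox (dir (k + 1)) b ∈ D →
        Follows (dir (k + 1)) x (extendTableau x₀ T (nextBox (dir (k + 1)) b)),
        pathSumTo w dir (content (start j)) k x =
      nextMatrix w dir start last k
          (fun i => extendTableau x₀ T (pathBox dir (start i) (k + 1))) i j -
        if content (start j) = k + 1 then 1 else 0 := by
    by_cases hl : k + 1 ≤ last i
    · rw [hhas hl, add_sub_cancel_right]
      simp only [hmem' hl, true_imp_iff]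
    -- The path ends at content `k`: every letter is compatible, and `pathSum` differs from the
    -- total by the empty join.
    · have hn : nextBox (dir (k + 1)) b ∉ D := fun hn => hl (hmem hn)
      have hlk : last i = k := by have := hi.2; omega
      rw [hlast (by omega), hlk, pathSum, add_sub_cancel_right]
      simp only [hn, false_imp_iff, filter_true]
  rw [e2]
  by_cases ho : otherBox (dir (k + 1)) b ∈ D
  · simp only [ho, true_and, if_true]
    ring
  · simp [ho, h0 ho]

-- Rows of paths that start at content `k + 1` are replaced first, which a unit column permits. What
-- remains is left multiplication by `1 - P`, where `P` links a box to the path through its other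
-- neighbour.
open Classical in
theorem IsPathDecomposition.det_sum_allowed [Fintype ι]
    (h : IsPathDecomposition D dir start last)
    (w : ℤ → X → R) {x₀ : X} {k : ℤ} {T : Tableau D X}
    (hT : T ∈ partialTableaux D x₀ (k + 1)) :
    (Matrix.of fun i j => ∑ x ∈ allowed D dir start last x₀ k T i,
        sweepRow w dir start last k i x j).det =
      (nextMatrix w dir start last k
        fun i => extendTableau x₀ T (pathBox dir (start i) (k + 1))).det := by
  set y : ι → X := fun i => extendTableau x₀ T (pathBox dir (start i) (k + 1)) with hy
  set A : Matrix ι ι R := Matrix.of fun i j => ∑ x ∈ allowed D dir start last x₀ k T i,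
    sweepRow w dir start last k i x j with hA
  set B := nextMatrix w dir start last k y with hB
  have hone : ∀ i, ¬ HasContent start last i k → ∀ j,
      A i j = sweepRow w dir start last k i x₀ j := by
    intro i hi j
    simp [hA, allowed, hi]
  have hact : ∀ i, HasContent start last i k → ∀ j, A i j =
      ∑ x ∈ allowed D dir start last x₀ k T i, pathSumTo w dir (content (start j)) k x := by
    intro i hi j
    have h1 : ¬ last i < k := by have := hi.2; omega
    have h2 : ¬ k < content (start i) := by have := hi.1; omega
    simp [hA, sweepRow, h1, h2]
  let C : Matrix ι ι R := Matrix.of fun i => if content (start i) = k + 1 then B i else A i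
  have hCs : ∀ i, content (start i) = k + 1 → C i = B i := fun i hi => if_pos hi
  have hCn : ∀ i, content (start i) ≠ k + 1 → C i = A i := fun i hi => if_neg hi
  have hAC : A.det = C.det := by
    by_cases hs : ∃ i, content (start i) = k + 1
    · obtain ⟨i, hi⟩ := hs
      have hil := h.start_le_last i
      refine det_eq_of_column_eq_single A C i (fun l => ?_) ?_ (fun l hl => ?_)
      · by_cases hl : HasContent start last l k
        · have hli : l ≠ i := by rintro rfl; have := hl.1; omega
          rw [hact l hl, if_neg hli]
          refine sum_eq_zero fun x _ => ?_
          rw [pathSumTo, if_neg (by omega)]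
        · rw [hone l hl, sweepRow]
          by_cases h1 : last l < k
          · have hli : l ≠ i := by rintro rfl; omega
            -- Since `last l < k` is strict, a start at `k + 1` leaves a gap, so the entry is 0 and
            -- not the 1 of an empty join.
            rw [if_pos h1, if_neg hli, pathSum_eq_zero _ _ (by omega)]
          · have h2 : k < content (start l) := by
              by_contra h2; exact hl ⟨by omega, by omega⟩
            rw [if_neg h1, if_pos h2]
      · rw [hCs i hi, hB, nextMatrix_of_hasContent w y ⟨by omega, by omega⟩, if_pos hi,
          sum_eq_zero, zero_add]
        intro x _
        rw [pathSumTo, if_neg (by omega)]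
      · exact (hCn l fun h' => hl (h.start_injective (h'.trans hi.symm))).symm
    · push Not at hs
      congr 1
      funext i
      exact (hCn i (hs i)).symm
  let P : Matrix ι ι R := Matrix.of fun i l =>
    if HasContent start last i k ∧ HasContent start last l (k + 1) ∧
      pathBox dir (start l) (k + 1) = otherBox (dir (k + 1)) (pathBox dir (start i) k)
    then 1 else 0
  have hCB : C = (1 - P) * B := by
    ext i j
    rw [sub_mul, one_mul, Matrix.sub_apply, Matrix.mul_apply]
    by_cases hi : HasContent start last i k
    · have hne : content (start i) ≠ k + 1 := by have := hi.1; omega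
      rw [hCn i hne, hact i hi, h.sum_allowed w hT hi]
      congr 1
      by_cases ho : otherBox (dir (k + 1)) (pathBox dir (start i) k) ∈ D
      · obtain ⟨l, hl, hb⟩ := (h.mem_iff _).1 ho
        rw [content_otherBox, content_pathBox] at hl hb
        rw [if_pos ho, sum_eq_single l]
        · have hPl : P i l = 1 := if_pos ⟨hi, hl, hb⟩
          rw [hPl, one_mul, hB, nextMatrix_of_hasContent w y hl, ← hb]
        · intro l' _ hl'
          have hPl : P i l' = 0 := if_neg fun ⟨_, h3, h4⟩ =>
            hl' (h.injective _ _ _ h3 hl (h4.trans hb.symm))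
          rw [hPl, zero_mul]
        · simp
      · rw [if_neg ho]
        refine (sum_eq_zero fun l _ => ?_).symm
        have hPl : P i l = 0 := if_neg fun ⟨_, h3, h4⟩ => ho (h4 ▸ h.pathBox_mem h3)
        rw [hPl, zero_mul]
    · rw [sum_eq_zero (fun l _ => by simp [P, hi]), sub_zero]
      by_cases hs : content (start i) = k + 1
      · rw [hCs i hs]
      · rw [hCn i hs, hone i hi, sweepRow]
        by_cases h1 : last i < k
        · rw [if_pos h1, hB, nextMatrix_of_last_lt w y (by omega)]
        · have h2 : k < content (start i) := by
            by_contra h2; exact hi ⟨by omega, by omega⟩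
          rw [if_neg h1, if_pos h2, hB,
            nextMatrix_of_lt_start w y (by omega) (h.start_le_last i)]
  have hP : (1 - P).det = 1 := by
    cases hd : dir (k + 1)
    -- The rank is the row, up to sign, in which the path reaches diagonal `k + 1`; a path that
    -- ended at `k` is prolonged by one step for this purpose.
    · refine det_one_sub_of_rank_lt P (fun i => (pathBox dir (start i) (k + 1)).1) ?_
      intro i l hil
      have hil : _ ∧ _ ∧ _ := of_not_not fun hn => hil (if_neg hn)
      rw [hil.2.2, pathBox_add_one dir (start i) hil.1.1, hd]
      simp [otherBox, nextBox, above, rightOf]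
    · refine det_one_sub_of_rank_lt P (fun i => -(pathBox dir (start i) (k + 1)).1) ?_
      intro i l hil
      have hil : _ ∧ _ ∧ _ := of_not_not fun hn => hil (if_neg hn)
      rw [hil.2.2, pathBox_add_one dir (start i) hil.1.1, hd]
      simp [otherBox, nextBox, above, rightOf]
  rw [hAC, hCB, Matrix.det_mul, hP, one_mul]

/-- The product of the weights of the boxes of content larger than `k`. -/
noncomputable def weightAbove (w : ℤ → X → R) (k : ℤ) (T : Tableau D X) : R :=
  ∏ p : {p : ℤ × ℤ // p ∈ D}, if k < content p.1 then w (content p.1) (T p) else 1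

open Classical in
theorem IsPathDecomposition.weightAbove_eq [Fintype ι]
    (h : IsPathDecomposition D dir start last) (w : ℤ → X → R) (x₀ : X) (k : ℤ)
    (T : Tableau D X) :
    weightAbove w k T = weightAbove w (k + 1) T *
      ∏ i, if HasContent start last i (k + 1) then
        w (k + 1) (extendTableau x₀ T (pathBox dir (start i) (k + 1))) else 1 := by
  have h1 : weightAbove w k T = weightAbove w (k + 1) T *
      ∏ p : {p : ℤ × ℤ // p ∈ D}, if content p.1 = k + 1 then w (k + 1) (T p) else 1 := by
    rw [weightAbove, weightAbove, ← prod_mul_distrib]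
    refine prod_congr rfl fun p _ => ?_
    rcases lt_trichotomy (content p.1) (k + 1) with hp | hp | hp
    · rw [if_neg (by omega), if_neg (by omega), if_neg (by omega), one_mul]
    · rw [if_pos (by omega), if_neg (by omega), if_pos (by omega), one_mul, hp]
    · rw [if_pos (by omega), if_pos (by omega), if_neg (by omega), mul_one]
  rw [h1, ← prod_filter, ← prod_filter]
  congr 1
  refine (prod_bij (fun i hi => ⟨pathBox dir (start i) (k + 1),
    h.pathBox_mem (mem_filter.1 hi).2⟩) ?_ ?_ ?_ ?_).symm
  · intro i _
    simp [content_pathBox]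
  · intro i hi j hj hij
    exact h.injective i j (k + 1) (mem_filter.1 hi).2 (mem_filter.1 hj).2 (Subtype.ext_iff.1 hij)
  · intro p hp
    have hp := (mem_filter.1 hp).2
    have h1 := h.hasContent_pathOf p
    have h2 := h.pathBox_pathOf p
    rw [hp] at h1 h2
    exact ⟨h.pathOf p, by simpa using h1, Subtype.ext h2⟩
  · intro i hi
    rw [extendTableau_of_mem]

open Classical in
theorem IsPathDecomposition.sweep_eq_sweep_add_one [Fintype ι]
    (h : IsPathDecomposition D dir start last) (w : ℤ → X → R) (x₀ : X) (k : ℤ) :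
    ∑ T ∈ partialTableaux D x₀ k, weightAbove w k T * (sweepMatrix w dir start last k
        fun i => extendTableau x₀ T (pathBox dir (start i) k)).det =
      ∑ T ∈ partialTableaux D x₀ (k + 1), weightAbove w (k + 1) T *
        (sweepMatrix w dir start last (k + 1)
          fun i => extendTableau x₀ T (pathBox dir (start i) (k + 1))).det := by
  rw [h.sum_partialTableaux x₀ k]
  refine sum_congr rfl fun T hT => ?_
  rw [det_sweepMatrix_add_one w k _ h.start_le_last, ← mul_assoc, ← h.weightAbove_eq w x₀ k T,
    ← h.det_sum_allowed w hT, ← sum_piFinset_det, mul_sum]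
  refine sum_congr rfl fun x _ => ?_
  congr 1
  · refine prod_congr rfl fun p _ => ?_
    split_ifs with hp
    · rw [setDiagonal, if_neg hp.ne']
    · rfl
  · congr 1
    ext i j
    by_cases hi : HasContent start last i k
    · simp [sweepMatrix, h.extend_setDiagonal_pathBox x₀ T x hi]
    · have : last i < k ∨ k < content (start i) := by
        by_contra hn
        push Not at hn
        exact hi ⟨hn.2, hn.1⟩
      simp only [sweepMatrix, Matrix.of_apply, sweepRow]
      split_ifs <;> first | rfl | omega

/-- Semistandard fillings: weakly increasing rows and strictly increasing columns. -/
def IsSemistandard (T : Tableau D X) : Prop :=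
  (∀ p q : {p : ℤ × ℤ // p ∈ D}, p.1.1 = q.1.1 → p.1.2 ≤ q.1.2 → T p ≤ T q) ∧
    ∀ p q : {p : ℤ × ℤ // p ∈ D}, p.1.2 = q.1.2 → p.1.1 < q.1.1 → T p < T q

/-- By convexity all boxes between two boxes of a row or column are in `D`, so comparisons of
neighbours can be chained. -/
theorem isSemistandard_iff (hD : ∀ p ∈ D, ∀ q ∈ D, ∀ m, p ≤ m → m ≤ q → m ∈ D) (x₀ : X)
    (T : Tableau D X) :
    IsSemistandard T ↔ ∀ p ∈ D, LocalCond D (extendTableau x₀ T) p := by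
  constructor
  · rintro ⟨hr, hc⟩ p hp
    refine ⟨fun hm => ?_, fun hm => ?_⟩
    · rw [extendTableau_of_mem _ _ hp, extendTableau_of_mem _ _ hm]
      exact hr _ _ rfl (by simp [rightOf])
    · rw [extendTableau_of_mem _ _ hp, extendTableau_of_mem _ _ hm]
      exact hc _ _ rfl (by simp [above])
  · intro h
    have hrow : ∀ (n : ℕ) (i j : ℤ), (i, j) ∈ D → (i, j + n) ∈ D →
        extendTableau x₀ T (i, j) ≤ extendTableau x₀ T (i, j + n) := by
      intro n
      induction n with
      | zero => intro i j _ _; simp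
      | succ n ih =>
        intro i j h1 h2
        have h3 : (i, j + (n : ℤ)) ∈ D := hD _ h1 _ h2 _ (by simp)
          (by simp only [Prod.mk_le_mk]; push_cast; omega)
        refine (ih i j h1 h3).trans ?_
        have e : (i, j + ((n + 1 : ℕ) : ℤ)) = rightOf (i, j + (n : ℤ)) := by
          simp [rightOf, add_assoc]
        rw [e] at h2 ⊢
        exact (h _ h3).1 h2
    have hcol : ∀ (n : ℕ) (i j : ℤ), (i, j) ∈ D → (i + (n + 1), j) ∈ D →
        extendTableau x₀ T (i, j) < extendTableau x₀ T (i + (n + 1), j) := by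
      intro n
      induction n with
      | zero =>
        intro i j h1 h2
        have e : (i, j) = above (i + (((0 : ℕ) : ℤ) + 1), j) := by simp [above]
        rw [e] at h1 ⊢
        exact (h _ h2).2 h1
      | succ n ih =>
        intro i j h1 h2
        have h3 : (i + ((n : ℤ) + 1), j) ∈ D := hD _ h1 _ h2 _
          (by simp only [Prod.mk_le_mk]; omega)
          (by simp only [Prod.mk_le_mk]; push_cast; omega)
        refine (ih i j h1 h3).trans ?_
        have e : (i + ((n : ℤ) + 1), j) = above (i + (((n + 1 : ℕ) : ℤ) + 1), j) := by
          simp [above]; ring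
        rw [e] at h3 ⊢
        exact (h _ h2).2 h3
    refine ⟨?_, ?_⟩
    · rintro ⟨⟨i, j⟩, hp⟩ ⟨⟨i', j'⟩, hq⟩ (rfl : i = i') (hj : j ≤ j')
      obtain ⟨n, rfl⟩ := Int.le.dest hj
      have := hrow n i j hp hq
      rwa [extendTableau_of_mem _ _ hp, extendTableau_of_mem _ _ hq] at this
    · rintro ⟨⟨i, j⟩, hp⟩ ⟨⟨i', j'⟩, hq⟩ (rfl : j = j') (hi : i < i')
      obtain ⟨n, rfl⟩ : ∃ n : ℕ, i' = i + (n + 1) := ⟨(i' - i - 1).toNat, by omega⟩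
      have := hcol n i j hp hq
      rwa [extendTableau_of_mem _ _ hp, extendTableau_of_mem _ _ hq] at this

open Classical in
/-- The weighted sum over the semistandard fillings of a diagram that is decomposed into paths
is the determinant of the weighted sums over the fillings of the joined paths. -/
theorem IsPathDecomposition.sum_eq_det [Fintype ι] [inst : DecidableEq ι] [Nonempty X]
    (h : IsPathDecomposition D dir start last) (w : ℤ → X → R) :
    ∑ T : Tableau D X with IsSemistandard T, ∏ p, w (content p.1) (T p) =
      (Matrix.of fun i j => pathSum w dir (content (start j)) (last i)).det := by
  -- The sweep lemmas carry the classical decidability instance; it has to be identified with the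
  -- given one.
  obtain rfl : inst = fun a b => Classical.propDecidable (a = b) := Subsingleton.elim _ _
  obtain ⟨x₀⟩ := ‹Nonempty X›
  obtain ⟨lo, hlo⟩ := (Set.finite_range fun i => content (start i)).bddBelow
  obtain ⟨hi, hhi⟩ := (Set.finite_range last).bddAbove
  -- At `lo - 1` no path has begun, so the sweep matrix there is the identity.
  have hlo : ∀ i, lo - 1 < content (start i) := fun i => by
    have : lo ≤ content (start i) := hlo ⟨i, rfl⟩
    omega
  have hhi : ∀ i, last i ≤ hi := fun i => hhi ⟨i, rfl⟩
  set f : ℤ → R := fun k => ∑ T ∈ partialTableaux D x₀ k, weightAbove w k T *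
    (sweepMatrix w dir start last k
      fun i => extendTableau x₀ T (pathBox dir (start i) k)).det with hf
  have hconst : ∀ n : ℕ, f (lo - 1) = f (lo - 1 + n) := by
    intro n
    induction n with
    | zero => simp
    | succ n ih =>
      rw [ih]
      push_cast
      rw [← add_assoc]
      exact h.sweep_eq_sweep_add_one w x₀ _
  have hD : ∀ p ∈ D, lo - 1 < content p ∧ content p ≤ hi := by
    intro p hp
    obtain ⟨i, hi, -⟩ := (h.mem_iff p).1 hp
    exact ⟨(hlo i).trans_le hi.1, hi.2.trans (hhi i)⟩
  have h1 : f (lo - 1) =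
      ∑ T : Tableau D X with IsSemistandard T, ∏ p, w (content p.1) (T p) := by
    have hset : partialTableaux D x₀ (lo - 1) =
        univ.filter fun T : Tableau D X => IsSemistandard T := by
      ext T
      rw [mem_partialTableaux, mem_filter, isSemistandard_iff h.convex x₀]
      refine ⟨fun hT => ⟨mem_univ _, fun p hp => hT.2 p hp (hD p hp).1.le⟩,
        fun hT => ⟨fun p hp => absurd hp (hD p p.2).1.not_gt, fun p hp _ => hT.2 p hp⟩⟩
    rw [hf, ← hset]
    refine sum_congr rfl fun T _ => ?_
    have hdet : ∀ y : ι → X, sweepMatrix w dir start last (lo - 1) y = 1 := by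
      intro y
      ext i j
      have h2 := hlo i
      have h3 := h.start_le_last i
      rw [sweepMatrix, Matrix.of_apply, sweepRow, if_neg (by omega), if_pos h2,
        Matrix.one_apply]
    rw [hdet, Matrix.det_one, mul_one]
    exact prod_congr rfl fun p _ => if_pos (hD p p.2).1
  obtain ⟨n, hn⟩ : ∃ n : ℕ, hi < lo - 1 + n := ⟨(hi - lo + 2).toNat, by omega⟩
  have h2 : f (lo - 1 + n) =
      (Matrix.of fun i j => pathSum w dir (content (start j)) (last i)).det := by
    -- Beyond the last diagonal no box is free, and only the constant filling by `x₀` remains.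
    have hset : partialTableaux D x₀ (lo - 1 + n) = {fun _ => x₀} := by
      ext T
      rw [mem_partialTableaux, mem_singleton]
      constructor
      · intro hT
        funext p
        exact hT.1 p ((hD p p.2).2.trans_lt hn)
      · rintro rfl
        exact ⟨fun _ _ => rfl, fun p hp hk => absurd (hD p hp).2 (by omega)⟩
    have hmat : ∀ y : ι → X, sweepMatrix w dir start last (lo - 1 + n) y =
        Matrix.of fun i j => pathSum w dir (content (start j)) (last i) := by
      intro y
      ext i j
      rw [sweepMatrix, Matrix.of_apply, sweepRow, if_pos ((hhi i).trans_lt hn), Matrix.of_apply]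
    have hwt : weightAbove w (lo - 1 + n) (fun _ => x₀ : Tableau D X) = 1 :=
      prod_eq_one fun p _ => if_neg (by have := (hD p p.2).2; omega)
    rw [hf]
    simp only [hset, sum_singleton, hmat, hwt, one_mul]
  rw [← h1, hconst n, h2]

end Sweep

/-! ### Convexity of skew diagrams and the shape of strips -/

theorem skewDiagram_convex (lam mu : YoungDiagram) : ∀ p ∈ skewDiagram lam mu,
    ∀ q ∈ skewDiagram lam mu, ∀ m, p ≤ m → m ≤ q → m ∈ skewDiagram lam mu := by
  intro p hp q hq m hpm hmq
  simp only [skewDiagram, mem_image, mem_sdiff, YoungDiagram.mem_cells] at *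
  obtain ⟨⟨a, b⟩, ⟨-, hab⟩, rfl⟩ := hp
  obtain ⟨⟨c, d⟩, ⟨hcd, -⟩, rfl⟩ := hq
  obtain ⟨m1, m2⟩ := m
  simp only [Prod.mk_le_mk] at hpm hmq
  refine ⟨((m1 - 1).toNat, (m2 - 1).toNat), ⟨?_, fun h => hab ?_⟩, ?_⟩
  · exact lam.up_left_mem (by omega) (by omega) hcd
  · exact mu.up_left_mem (by omega) (by omega) h
  · simp only [Prod.mk.injEq]; omega

section Strips

variable {t : Finset (ℤ × ℤ)}

theorem IsStrip.convex (ht : IsStrip t) : ∀ p ∈ t, ∀ q ∈ t, ∀ m, p ≤ m → m ≤ q → m ∈ t := by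
  obtain ⟨al, be, -, rfl⟩ := ht.skew
  exact skewDiagram_convex al be

/-- Two boxes on one diagonal would, by convexity, enclose a forbidden `2 × 2` block. -/
theorem IsStrip.eq_of_content_eq (ht : IsStrip t) {p q : ℤ × ℤ} (hp : p ∈ t) (hq : q ∈ t)
    (h : content p = content q) : p = q := by
  have key : ∀ p ∈ t, ∀ q ∈ t, content p = content q → ¬ p.1 < q.1 := by
    rintro ⟨i, j⟩ hp ⟨i', j'⟩ hq h hlt
    simp only [content] at h hlt
    refine ht.no_block i j ⟨hp, ?_, ?_, ?_⟩ <;>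
    exact ht.convex _ hp _ hq _ (by simp only [Prod.mk_le_mk]; omega)
      (by simp only [Prod.mk_le_mk]; omega)
  have h1 := key p hp q hq h
  have h2 := key q hq p hp h.symm
  simp only [content] at h
  ext <;> omega

theorem IsStrip.exists_boundary (ht : IsStrip t) {S : Set (ℤ × ℤ)} {p q : ℤ × ℤ}
    (hp : p ∈ t) (hq : q ∈ t) (hpS : p ∈ S) (hqS : q ∉ S) :
    ∃ u ∈ t, ∃ v ∈ t, u ∈ S ∧ v ∉ S ∧ |u.1 - v.1| + |u.2 - v.2| = 1 := by
  obtain ⟨W⟩ := ht.connected.preconnected ⟨p, hp⟩ ⟨q, hq⟩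
  obtain ⟨e, -, h1, h2⟩ := W.exists_boundary_dart (Subtype.val ⁻¹' S) hpS hqS
  exact ⟨e.fst, e.fst.2, e.snd, e.snd.2, h1, h2, e.adj⟩

theorem IsStartBox.content_le {s p : ℤ × ℤ} (hs : IsStartBox t s) (hp : p ∈ t) :
    content s ≤ content p := by
  have := hs.2 p hp
  simp only [content]; omega

theorem IsEndBox.content_le {s p : ℤ × ℤ} (hs : IsEndBox t s) (hp : p ∈ t) :
    content p ≤ content s := by
  have := hs.2 p hp
  simp only [content]; omega

/-- A walk in the strip from `p` to the starting box must step from content `content p` to the next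
smaller one. It does so at `p`, the only box of its content, and such a step goes left or down. -/
theorem IsStrip.left_or_below_mem (ht : IsStrip t) {s p : ℤ × ℤ} (hs : IsStartBox t s)
    (hp : p ∈ t) (hne : p ≠ s) : leftOf p ∈ t ∨ below p ∈ t := by
  have hlt : content s < content p := lt_of_le_of_ne (hs.content_le hp)
    fun h => hne (ht.eq_of_content_eq hp hs.1 h.symm)
  obtain ⟨u, hu, v, hv, huS, hvS, huv⟩ :=
    ht.exists_boundary (S := {q | content p ≤ content q}) hp hs.1 (le_refl (content p)) (not_le.2 hlt)
  simp only [Set.mem_ofPred_eq, not_le] at huS hvS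
  have h2 : content u = content p ∧ (v = leftOf u ∨ v = below u) := by
    obtain ⟨u1, u2⟩ := u
    obtain ⟨v1, v2⟩ := v
    simp only [content, leftOf, below, Prod.mk.injEq] at *
    rcases abs_cases (u1 - v1) with h1 | h1 <;> rcases abs_cases (u2 - v2) with h2 | h2 <;> omega
  obtain rfl := ht.eq_of_content_eq hu hp h2.1
  rcases h2.2 with rfl | rfl
  · exact Or.inl hv
  · exact Or.inr hv

theorem IsStrip.right_or_above_mem (ht : IsStrip t) {e p : ℤ × ℤ} (he : IsEndBox t e)
    (hp : p ∈ t) (hne : p ≠ e) : rightOf p ∈ t ∨ above p ∈ t := by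
  have hlt : content p < content e := lt_of_le_of_ne (he.content_le hp)
    fun h => hne (ht.eq_of_content_eq hp he.1 h)
  obtain ⟨u, hu, v, hv, huS, hvS, huv⟩ :=
    ht.exists_boundary (S := {q | content q ≤ content p}) hp he.1 (le_refl (content p)) (not_le.2 hlt)
  simp only [Set.mem_ofPred_eq, not_le] at huS hvS
  have h2 : content u = content p ∧ (v = rightOf u ∨ v = above u) := by
    obtain ⟨u1, u2⟩ := u
    obtain ⟨v1, v2⟩ := v
    simp only [content, rightOf, above, Prod.mk.injEq] at *
    rcases abs_cases (u1 - v1) with h1 | h1 <;> rcases abs_cases (u2 - v2) with h2 | h2 <;> omega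
  obtain rfl := ht.eq_of_content_eq hu hp h2.1
  rcases h2.2 with rfl | rfl
  · exact Or.inl hv
  · exact Or.inr hv

end Strips

/-! ### From outside decompositions to path decompositions -/

theorem content_leftOf (p : ℤ × ℤ) : content (leftOf p) = content p - 1 := by
  simp only [content, leftOf]; ring

theorem content_below (p : ℤ × ℤ) : content (below p) = content p - 1 := by
  simp only [content, below]; ring

theorem leftOf_ne_below (p : ℤ × ℤ) : leftOf p ≠ below p := by
  simp [leftOf, below]

namespace OutsideDecomposition

variable {D : Finset (ℤ × ℤ)} {r : ℕ} (d : OutsideDecomposition D r)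

theorem mem_iff {p : ℤ × ℤ} : p ∈ D ↔ ∃ i, p ∈ d.strip i := by
  conv_lhs => rw [← d.union]
  simp

theorem strip_injective {i j : Fin r} {p : ℤ × ℤ} (hi : p ∈ d.strip i) (hj : p ∈ d.strip j) :
    i = j := by
  by_contra hne
  exact Finset.disjoint_left.1 (d.disjoint i j hne) hi hj

section PathDecomposition

variable {d} {dir : ℤ → Approach}

theorem IsApproach.pathBox_mem (h : d.IsApproach dir) (i : Fin r) {k : ℤ}
    (h1 : content (d.start i) ≤ k) (h2 : k ≤ content (d.finish i)) :
    pathBox dir (d.start i) k ∈ d.strip i := by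
  induction k, h1 using Int.leInduction with
  | base => rw [pathBox_content]; exact (d.isStartBox i).1
  | succ k hk ih =>
    have hb := ih (by omega)
    rw [pathBox_add_one dir _ hk]
    have hc := content_pathBox dir (d.start i) k
    generalize pathBox dir (d.start i) k = b at *
    have hne : b ≠ d.finish i := by rintro rfl; omega
    rcases (d.isStrip i).right_or_above_mem (d.isEndBox i) hb hne with hm | hm
    · have hd := (h i _ hm).1 (by simpa [leftOf, rightOf] using hb)
      have hcr : content (rightOf b) = k + 1 := by rw [← hc]; exact content_nextBox .fromLeft b
      rw [hcr] at hd
      rwa [hd]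
    · have hd := (h i _ hm).2.1 (by simpa [below, above] using hb)
      have hcr : content (above b) = k + 1 := by rw [← hc]; exact content_nextBox .fromBelow b
      rw [hcr] at hd
      rwa [hd]

theorem IsApproach.mem_strip_iff (h : d.IsApproach dir) (i : Fin r) (p : ℤ × ℤ) :
    p ∈ d.strip i ↔
      HasContent d.start (fun i => content (d.finish i)) i (content p) ∧
        pathBox dir (d.start i) (content p) = p := by
  constructor
  · intro hp
    have h1 := (d.isStartBox i).content_le hp
    have h2 := (d.isEndBox i).content_le hp
    exact ⟨⟨h1, h2⟩, (d.isStrip i).eq_of_content_eq (h.pathBox_mem i h1 h2) hp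
      (content_pathBox ..)⟩
  · rintro ⟨⟨h1, h2⟩, hp⟩
    rw [← hp]
    exact h.pathBox_mem i h1 h2

theorem IsApproach.isPathDecomposition (h : d.IsApproach dir)
    (hD : ∀ p ∈ D, ∀ q ∈ D, ∀ m, p ≤ m → m ≤ q → m ∈ D) :
    IsPathDecomposition D dir d.start (fun i => content (d.finish i)) := by
  have hstart : ∀ i, prevBox (dir (content (d.start i))) (d.start i) ∉ D := by
    intro i
    rcases (h i _ (d.isStartBox i).1).2.2 rfl with ⟨h1, h2⟩ | ⟨h1, h2⟩ <;> rw [h2] <;> exact h1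
  have hinj : ∀ i j k, HasContent d.start (fun i => content (d.finish i)) i k →
      HasContent d.start (fun i => content (d.finish i)) j k →
      pathBox dir (d.start i) k = pathBox dir (d.start j) k → i = j := by
    intro i j k hi hj hij
    refine d.strip_injective (h.pathBox_mem i hi.1 hi.2) ?_
    rw [hij]
    exact h.pathBox_mem j hj.1 hj.2
  refine ⟨hD, fun i => (d.isEndBox i).content_le (d.isStartBox i).1, fun p => ?_, hinj, hstart, ?_⟩
  · rw [d.mem_iff]
    exact exists_congr fun i => h.mem_strip_iff i p
  · intro i k hi hq
    obtain ⟨j, hj⟩ := d.mem_iff.1 hq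
    obtain ⟨hcj, hbj⟩ := (h.mem_strip_iff j _).1 hj
    rw [content_nextBox, content_pathBox] at hcj hbj
    -- The successor either starts strip `j`, although the box it is approached from lies in `D`, or
    -- is preceded in strip `j` by the box of strip `i`, whence `j = i`.
    rcases hcj.1.eq_or_lt with hs | hs
    · exfalso
      rw [← hs, pathBox_content, hs] at hbj
      have := hstart j
      rw [hs, hbj, prevBox_nextBox] at this
      exact this (d.mem_iff.2 ⟨i, h.pathBox_mem i hi.1 hi.2⟩)
    · have hs : content (d.start j) ≤ k := by omega
      rw [pathBox_add_one dir _ hs] at hbj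
      have hb := congrArg (prevBox (dir (k + 1))) hbj
      rw [prevBox_nextBox, prevBox_nextBox] at hb
      have hjk : HasContent d.start (fun i => content (d.finish i)) j k :=
        ⟨hs, by have := hcj.2; omega⟩
      rw [hinj i j k hi hjk hb.symm]
      exact hcj.2

end PathDecomposition

/-! ### Existence of a direction assignment -/

section Existence

/-- The box `p` of the `i`-th strip may be regarded as approached from the left. -/
def FromLeft (i : Fin r) (p : ℤ × ℤ) : Prop :=
  leftOf p ∈ d.strip i ∨ p = d.start i ∧ leftOf p ∉ D

/-- The box `p` of the `i`-th strip may be regarded as approached from below. -/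
def FromBelow (i : Fin r) (p : ℤ × ℤ) : Prop :=
  below p ∈ d.strip i ∨ p = d.start i ∧ below p ∉ D

theorem fromLeft_or_fromBelow {i : Fin r} {p : ℤ × ℤ} (hp : p ∈ d.strip i) :
    d.FromLeft i p ∨ d.FromBelow i p := by
  by_cases hs : p = d.start i
  · rcases d.start_perimeter i with h | h
    · exact Or.inl (Or.inr ⟨hs, hs ▸ h⟩)
    · exact Or.inr (Or.inr ⟨hs, hs ▸ h⟩)
  · exact ((d.isStrip i).left_or_below_mem (d.isStartBox i) hp hs).imp Or.inl Or.inl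

theorem leftOf_start_notMem (i : Fin r) : leftOf (d.start i) ∉ d.strip i := fun h => by
  have := (d.isStartBox i).content_le h
  rw [content_leftOf] at this
  omega

theorem below_start_notMem (i : Fin r) : below (d.start i) ∉ d.strip i := fun h => by
  have := (d.isStartBox i).content_le h
  rw [content_below] at this
  omega

theorem not_left_and_below_mem (i : Fin r) (p : ℤ × ℤ) (h1 : leftOf p ∈ d.strip i)
    (h2 : below p ∈ d.strip i) : False :=
  leftOf_ne_below p ((d.isStrip i).eq_of_content_eq h1 h2
    ((content_leftOf p).trans (content_below p).symm))

theorem not_fromLeft_of_below_mem {i : Fin r} {p : ℤ × ℤ} (h : below p ∈ d.strip i) :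
    ¬ d.FromLeft i p := by
  rintro (h1 | ⟨rfl, -⟩)
  · exact d.not_left_and_below_mem i p h1 h
  · exact d.below_start_notMem i h

theorem not_fromBelow_of_leftOf_mem {i : Fin r} {p : ℤ × ℤ} (h : leftOf p ∈ d.strip i) :
    ¬ d.FromBelow i p := by
  rintro (h1 | ⟨rfl, -⟩)
  · exact d.not_left_and_below_mem i p h h1
  · exact d.leftOf_start_notMem i h

/-- The box following `p` on its diagonal. -/
def diagNext (p : ℤ × ℤ) : ℤ × ℤ := (p.1 + 1, p.2 + 1)

theorem below_mem_of_diagNext_mem (hD : ∀ p ∈ D, ∀ q ∈ D, ∀ m, p ≤ m → m ≤ q → m ∈ D)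
    {p : ℤ × ℤ} (hp : p ∈ D) (hq : diagNext p ∈ D) : below p ∈ D :=
  hD _ hp _ hq _ (by obtain ⟨a, b⟩ := p; simp [below])
    (by obtain ⟨a, b⟩ := p; simp [below, diagNext])

theorem leftOf_diagNext (p : ℤ × ℤ) : leftOf (diagNext p) = below p := by
  simp [leftOf, diagNext, below]

/-- The box below `p` has both its upper and its right neighbour in `D`, so it is not an ending box.
Its strip goes on either to `diagNext p`, which is then approached from the left, or to `p`, which
is then approached from below. -/
theorem not_fromBelow_diagNext (hD : ∀ p ∈ D, ∀ q ∈ D, ∀ m, p ≤ m → m ≤ q → m ∈ D)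
    {i j : Fin r} {p : ℤ × ℤ} (hp : p ∈ d.strip i) (hq : diagNext p ∈ d.strip j)
    (h : d.FromLeft i p) : ¬ d.FromBelow j (diagNext p) := by
  have hpD := d.mem_iff.2 ⟨i, hp⟩
  have hqD := d.mem_iff.2 ⟨j, hq⟩
  obtain ⟨l, hl⟩ := d.mem_iff.1 (below_mem_of_diagNext_mem hD hpD hqD)
  have hr : rightOf (below p) = diagNext p := rfl
  have ha : above (below p) = p := by simp [above, below]
  have hne : below p ≠ d.finish l := by
    intro he
    have := d.finish_perimeter l
    rw [← he, hr, ha] at this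
    exact this.elim (fun h => h hqD) (fun h => h hpD)
  rcases (d.isStrip l).right_or_above_mem (d.isEndBox l) hl hne with hm | hm
  · rw [hr] at hm
    obtain rfl := d.strip_injective hm hq
    exact d.not_fromBelow_of_leftOf_mem ((leftOf_diagNext p).symm ▸ hl)
  · rw [ha] at hm
    obtain rfl := d.strip_injective hm hp
    exact absurd h (d.not_fromLeft_of_below_mem hl)

/-- The box below `p` lies in `D`, so neither alternative can come from the perimeter. Otherwise
this box would put `p` and `diagNext p` into one strip, which has only one box per content. -/
theorem not_fromLeft_diagNext (hD : ∀ p ∈ D, ∀ q ∈ D, ∀ m, p ≤ m → m ≤ q → m ∈ D)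
    {i j : Fin r} {p : ℤ × ℤ} (hp : p ∈ d.strip i) (hq : diagNext p ∈ d.strip j)
    (h : d.FromBelow i p) : ¬ d.FromLeft j (diagNext p) := by
  have hbD := below_mem_of_diagNext_mem hD (d.mem_iff.2 ⟨i, hp⟩) (d.mem_iff.2 ⟨j, hq⟩)
  rintro (h1 | ⟨-, h1⟩) <;> rw [leftOf_diagNext] at h1
  · rcases h with h2 | ⟨-, h2⟩
    · obtain rfl := d.strip_injective h1 h2
      have := (d.isStrip j).eq_of_content_eq hp hq (by simp [content, diagNext])
      simp [diagNext, Prod.ext_iff] at this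
    · exact h2 hbD
  · exact h1 hbD

theorem approach_along_diagonal (hD : ∀ p ∈ D, ∀ q ∈ D, ∀ m, p ≤ m → m ≤ q → m ∈ D) (n : ℕ) :
    ∀ {i j : Fin r} {p : ℤ × ℤ}, p ∈ d.strip i → (p.1 + (n + 1), p.2 + (n + 1)) ∈ d.strip j →
      (d.FromLeft i p → ¬ d.FromBelow j (p.1 + (n + 1), p.2 + (n + 1))) ∧
      (d.FromBelow i p → ¬ d.FromLeft j (p.1 + (n + 1), p.2 + (n + 1))) := by
  induction n with
  | zero =>
    intro i j p hp hq
    have e : (p.1 + (((0 : ℕ) : ℤ) + 1), p.2 + (((0 : ℕ) : ℤ) + 1)) = diagNext p := by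
      simp [diagNext]
    rw [e] at hq ⊢
    exact ⟨d.not_fromBelow_diagNext hD hp hq, d.not_fromLeft_diagNext hD hp hq⟩
  | succ n ih =>
    intro i j p hp hq
    have e : (p.1 + (((n + 1 : ℕ) : ℤ) + 1), p.2 + (((n + 1 : ℕ) : ℤ) + 1)) =
        diagNext (p.1 + ((n : ℤ) + 1), p.2 + ((n : ℤ) + 1)) := by
      simp only [diagNext, Prod.mk.injEq]; push_cast; constructor <;> ring
    have hm : (p.1 + ((n : ℤ) + 1), p.2 + ((n : ℤ) + 1)) ∈ D := by
      refine hD _ (d.mem_iff.2 ⟨i, hp⟩) _ (d.mem_iff.2 ⟨j, hq⟩) _ ?_ ?_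
      · obtain ⟨a, b⟩ := p
        simp only [Prod.mk_le_mk]; omega
      · simp only [Prod.mk_le_mk]; push_cast; omega
    obtain ⟨l, hl⟩ := d.mem_iff.1 hm
    rw [e] at hq ⊢
    have h1 := ih hp hl
    have h2 := d.fromLeft_or_fromBelow hl
    exact ⟨fun h => d.not_fromBelow_diagNext hD hl hq (h2.resolve_right (h1.1 h)),
      fun h => d.not_fromLeft_diagNext hD hl hq (h2.resolve_left (h1.2 h))⟩

/-- Directions propagate along a diagonal, so a box that admits both is alone on its diagonal. This
is why the free choice at such a starting box causes no conflict. -/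
theorem eq_of_fromLeft_of_fromBelow (hD : ∀ p ∈ D, ∀ q ∈ D, ∀ m, p ≤ m → m ≤ q → m ∈ D)
    {i j : Fin r} {p q : ℤ × ℤ} (hp : p ∈ d.strip i) (hq : q ∈ d.strip j)
    (hpq : content p = content q) (h1 : d.FromLeft i p) (h2 : d.FromBelow j q) : p = q := by
  obtain ⟨p1, p2⟩ := p
  obtain ⟨q1, q2⟩ := q
  simp only [content] at hpq
  rcases lt_trichotomy p1 q1 with h | h | h
  · have e : (q1, q2) = (p1 + (((q1 - p1 - 1).toNat : ℤ) + 1),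
        p2 + (((q1 - p1 - 1).toNat : ℤ) + 1)) := by
      simp only [Prod.mk.injEq]; omega
    rw [e] at hq h2
    exact absurd h2 ((d.approach_along_diagonal hD _ hp hq).1 h1)
  · simp only [Prod.mk.injEq]; omega
  · have e : (p1, p2) = (q1 + (((p1 - q1 - 1).toNat : ℤ) + 1),
        q2 + (((p1 - q1 - 1).toNat : ℤ) + 1)) := by
      simp only [Prod.mk.injEq]; omega
    rw [e] at hp h1
    exact absurd h1 ((d.approach_along_diagonal hD _ hq hp).2 h2)

open Classical in
theorem exists_isApproach (hD : ∀ p ∈ D, ∀ q ∈ D, ∀ m, p ≤ m → m ≤ q → m ∈ D) :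
    ∃ dir, d.IsApproach dir := by
  refine ⟨fun c => if ∃ i, ∃ p ∈ d.strip i, content p = c ∧ d.FromLeft i p then .fromLeft
    else .fromBelow, fun i p hp => ?_⟩
  by_cases hex : ∃ j, ∃ q ∈ d.strip j, content q = content p ∧ d.FromLeft j q
  · obtain ⟨j, q, hq, hqp, hL⟩ := hex
    have hB : d.FromBelow i p → d.FromLeft i p := by
      intro hB
      obtain rfl := d.eq_of_fromLeft_of_fromBelow hD hq hp hqp hL hB
      obtain rfl := d.strip_injective hq hp
      exact hL
    have hLp := (d.fromLeft_or_fromBelow hp).elim id hB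
    beta_reduce
    rw [if_pos ⟨j, q, hq, hqp, hL⟩]
    refine ⟨fun _ => rfl, fun h => absurd hLp (d.not_fromLeft_of_below_mem h), ?_⟩
    rintro rfl
    exact Or.inl ⟨hLp.elim (fun h => absurd h (d.leftOf_start_notMem i)) And.right, rfl⟩
  · have hLp : ¬ d.FromLeft i p := fun h => hex ⟨i, p, hp, rfl, h⟩
    have hBp := (d.fromLeft_or_fromBelow hp).resolve_left hLp
    beta_reduce
    rw [if_neg hex]
    refine ⟨fun h => absurd (Or.inl h) hLp, fun _ => rfl, ?_⟩
    rintro rfl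
    exact Or.inr ⟨hBp.elim (fun h => absurd h (d.below_start_notMem i)) And.right, rfl⟩

end Existence

end OutsideDecomposition

/-! ### Joined strips as single paths -/

section Join

variable (dir : ℤ → Approach) (s : ℤ × ℤ)

theorem pathBox_mono {k l : ℤ} (hk : content s ≤ k) (hkl : k ≤ l) :
    (pathBox dir s l).1 ≤ (pathBox dir s k).1 ∧ (pathBox dir s k).2 ≤ (pathBox dir s l).2 := by
  induction l, hkl using Int.leInduction with
  | base => exact ⟨le_rfl, le_rfl⟩
  | succ l hl ih =>
    rw [pathBox_add_one dir s (hk.trans hl)]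
    cases dir (l + 1) <;> simp only [nextBox, rightOf, above] <;> omega

theorem mem_image_pathBox {d : ℤ} {p : ℤ × ℤ} :
    p ∈ (Icc (content s) d).image (pathBox dir s) ↔
      (content s ≤ content p ∧ content p ≤ d) ∧ pathBox dir s (content p) = p := by
  rw [mem_image]
  constructor
  · rintro ⟨k, hk, rfl⟩
    rw [content_pathBox]
    exact ⟨mem_Icc.1 hk, rfl⟩
  · rintro ⟨h1, h2⟩
    exact ⟨content p, mem_Icc.2 h1, h2⟩

theorem eq_pathBox_of_row {p : ℤ × ℤ} (h : (pathBox dir s (content p)).1 = p.1) :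
    pathBox dir s (content p) = p := by
  have := content_pathBox dir s (content p)
  simp only [content] at this h ⊢
  ext <;> omega

theorem eq_pathBox_of_column {p : ℤ × ℤ} (h : (pathBox dir s (content p)).2 = p.2) :
    pathBox dir s (content p) = p := by
  have := content_pathBox dir s (content p)
  simp only [content] at this h ⊢
  ext <;> omega

/-- This lets `sum_eq_det`, with a `1 × 1` matrix, evaluate the sum over fillings of a joined strip.
-/
theorem isPathDecomposition_path {d : ℤ} (hd : content s ≤ d) :
    IsPathDecomposition ((Icc (content s) d).image (pathBox dir s)) dir
      (fun _ : Unit => s) (fun _ => d) := by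
  refine ⟨?_, fun _ => hd, fun p => ?_, fun _ _ _ _ _ _ => rfl, fun _ h => ?_, fun _ k hk h => ?_⟩
  · intro p hp q hq m hpm hmq
    rw [mem_image_pathBox] at *
    obtain ⟨⟨hp1, hp2⟩, hp⟩ := hp
    obtain ⟨⟨hq1, hq2⟩, hq⟩ := hq
    have h1 := hpm.1
    have h2 := hpm.2
    have h3 := hmq.1
    have h4 := hmq.2
    have c1 : content p = p.2 - p.1 := rfl
    have c2 : content q = q.2 - q.1 := rfl
    have c3 : content m = m.2 - m.1 := rfl
    -- A path moves only right and up, so `p ≤ q` forces both into one row or one column, according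
    -- to the order of their contents.
    rcases le_total (content p) (content q) with hle | hle
    · have m1 := pathBox_mono dir s hp1 hle
      rw [hp, hq] at m1
      have m2 := pathBox_mono dir s hp1 (l := content m) (by omega)
      have m3 := pathBox_mono dir s (k := content m) (l := content q) (by omega) (by omega)
      rw [hp] at m2
      rw [hq] at m3
      exact ⟨⟨by omega, by omega⟩, eq_pathBox_of_row dir s (by omega)⟩
    · have m1 := pathBox_mono dir s hq1 hle
      rw [hp, hq] at m1
      have m2 := pathBox_mono dir s hq1 (l := content m) (by omega)
      have m3 := pathBox_mono dir s (k := content m) (l := content p) (by omega) (by omega)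
      rw [hq] at m2
      rw [hp] at m3
      exact ⟨⟨by omega, by omega⟩, eq_pathBox_of_column dir s (by omega)⟩
  · rw [mem_image_pathBox]
    simp [HasContent]
  · rw [mem_image_pathBox] at h
    have := h.1.1
    have e := content_nextBox (dir (content s)) (prevBox (dir (content s)) s)
    rw [nextBox_prevBox] at e
    omega
  · rw [mem_image_pathBox, content_nextBox, content_pathBox] at h
    exact h.1.2

end Join

/-! ### Zeta functions as weighted sums -/

/-- The weight of the letter `x` in a box of content `c`. -/
noncomputable def symplecticWeight (N : ℕ) (a : ℤ → ℂ) (c : ℤ) (x : Letter N) : ℂ :=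
  if -c + 1 ≤ (x.number : ℤ) then 1 / ((x.abs : ℝ) : ℂ) ^ a c else 0

open Classical in
theorem zeta_eq_sum (N : ℕ) (D : Finset (ℤ × ℤ)) (a : ℤ → ℂ) (s : Tableau D ℂ)
    (hs : ∀ p, s p = a (content p)) :
    zeta N D s = ∑ T : Tableau D (Letter N) with IsSemistandard T,
      ∏ p, symplecticWeight N a (content p.1) (T p) := by
  have h : ∀ T : Tableau D (Letter N), ∏ p, symplecticWeight N a (content p.1) (T p) =
      if ∀ p : {p : ℤ × ℤ // p ∈ D}, -content p + 1 ≤ ((T p).number : ℤ) then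
        1 / ∏ p, (((T p).abs : ℝ) : ℂ) ^ s p else 0 := by
    intro T
    split_ifs with hT
    · rw [one_div, ← prod_inv_distrib]
      refine prod_congr rfl fun p _ => ?_
      rw [symplecticWeight, if_pos (hT p), one_div, hs]
    · push Not at hT
      obtain ⟨p, hp⟩ := hT
      exact prod_eq_zero (mem_univ p) (if_neg (not_le.2 hp))
  simp only [h]
  rw [zeta, ← sum_filter, filter_filter]
  refine sum_congr ?_ fun _ _ => rfl
  ext T
  simp only [mem_filter, mem_univ, true_and]
  exact ⟨fun ⟨h1, h2, h3⟩ => ⟨⟨h1, h2⟩, h3⟩, fun ⟨⟨h1, h2⟩, h3⟩ => ⟨h1, h2, h3⟩⟩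

/-- The conventions for undefined and empty joins are exactly the values 0 and 1 built into
`pathSum`. -/
theorem OutsideDecomposition.joinZeta_eq {N : ℕ} (hN : 0 < N) {D : Finset (ℤ × ℤ)} {r : ℕ}
    (d : OutsideDecomposition D r) (dir : ℤ → Approach) (a : ℤ → ℂ) (i j : Fin r) :
    d.joinZeta N dir a i j =
      pathSum (symplecticWeight N a) dir (content (d.start j)) (content (d.finish i)) := by
  have : Nonempty (Letter N) := ⟨toLex (⟨0, hN⟩, false)⟩
  rw [joinZeta]
  split_ifs with h
  · exact (pathSum_eq_zero _ _ h).symm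
  · rcases le_or_gt (content (d.start j)) (content (d.finish i)) with hle | hlt
    · rw [zeta_eq_sum N _ a (contentTableau a _) fun _ => rfl]
      have := (isPathDecomposition_path dir (d.start j) hle).sum_eq_det (symplecticWeight N a)
      rw [Matrix.det_unique] at this
      exact this
    · have he : content (d.start j) = content (d.finish i) + 1 := by
        have : ¬ content (d.finish i) + 1 < content (d.start j) := h
        omega
      have hempty : d.join dir i j = ∅ := by
        rw [join, Icc_eq_empty (not_le.2 hlt), image_empty]
      rw [pathSum_eq_one _ _ he, hempty, zeta]
      classical
      rw [filter_true_of_mem fun T _ => ⟨fun p => absurd p.2 (notMem_empty _),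
        fun p => absurd p.2 (notMem_empty _), fun p => absurd p.2 (notMem_empty _)⟩]
      simp

end SpZeta

theorem mainTheorem6 (lam mu : YoungDiagram) (hmu : mu ≤ lam) (N : ℕ) (hN : 0 < N)
    (s : SpZeta.Tableau (SpZeta.skewDiagram lam mu) ℂ) (hs : SpZeta.IsDiagonal s)
    (r : ℕ) (d : SpZeta.OutsideDecomposition (SpZeta.skewDiagram lam mu) r) :
    (∃ dir : ℤ → SpZeta.Approach, d.IsApproach dir) ∧
    ∀ dir : ℤ → SpZeta.Approach, d.IsApproach dir →
    ∀ a : ℤ → ℂ, (∀ p, s p = a (SpZeta.content p)) →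
      SpZeta.zeta N (SpZeta.skewDiagram lam mu) s =
        Matrix.det (Matrix.of fun i j : Fin r => d.joinZeta N dir a i j) := by
  have hD := SpZeta.skewDiagram_convex lam mu
  -- The sweep needs some letter to pad unfilled boxes.
  have : Nonempty (SpZeta.Letter N) := ⟨toLex (⟨0, hN⟩, false)⟩
  refine ⟨d.exists_isApproach hD, fun dir hdir a ha => ?_⟩
  rw [SpZeta.zeta_eq_sum N _ a s ha,
    (hdir.isPathDecomposition hD).sum_eq_det (SpZeta.symplecticWeight N a)]
  simp only [d.joinZeta_eq hN dir a]
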